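/- Let $n\ge 1$, $s\in(0,1)$, let $\Omega\subset\mathbb R^n$ be a bounded open set with $C^{1,1}$ boundary, and let $v:\mathbb R^n\to\mathbb R$ be (Lebesgue measurable and) locally bounded, i.e. $\sup_{|x|\le r}|v(x)|<\infty$ for every $r>0$. Write $\Omega^k:=\Omega\times(-k,k)$, $\Omega^\infty:=\Omega\times\mathbb R$ (subsets of $\mathbb R^{n+1}$) and $\mathrm{Sg}(v):=\{(x,t)\in\mathbb R^{n+1}: t<v(x)\}$. All sets are Lebesgue measurable, $\mathcal C E$ is the complement of $E$, and equalities and inclusions of sets are understood up to Lebesgue null sets. For an open set $U\subset\mathbb R^{n+1}$ and $E\subset\mathbb R^{n+1}$ let $$P_s(E,U):=\mathcal L_s(E\cap U,\mathcal CE\cap U)+\mathcal L_s(E\cap U,\mathcal CE\setminus U)+\mathcal L_s(E\setminus U,\mathcal CE\cap U),\qquad \mathcal L_s(A,B):=\int_A\int_B\frac{dX\,dY}{|X-Y|^{n+1+s}}.$$ The set $E$ is $s$-minimal in $U$ if $P_s(E,U)<\infty$ and $P_s(E,U)\le P_s(F,U)$ for every $F$ with $F\setminus U=E\setminus U$; it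 is locally $s$-minimal in $U$ if it is $s$-minimal in every open set $U'$ whose closure is compact and contained in $U$. Call $M>0$ an a priori height bound (for $n,s,\Omega,v$) if every set $E\subset\mathbb R^{n+1}$ that is locally $s$-minimal in $\Omega^\infty$ with $E\setminus\Omega^\infty=\mathrm{Sg}(v)\setminus\Omega^\infty$ satisfies $$\Omega\times(-\infty,-M]\subset E\cap\Omega^\infty\subset\Omega\times(-\infty,M]\quad\text{and}\quad E\setminus(\Omega\times[-M,M])=\mathrm{Sg}(v)\setminus(\Omega\times[-M,M]).$$ Then an a priori height bound exists. Moreover, let $M>0$ be any a priori height bound and let $k_0$ be the smallest integer with $k_0>M$. If $F\subset\mathbb R^{n+1}$ is $s$-minimal in $\Omega^{k_0}$ and $F\setminus\Omega^{k_0}=\mathrm{Sg}(v)\setminus\Omega^{k_0}$, then $F$ is $s$-minimal in $\Omega^k$ for every real $k\ge k_0$, and $F$ is locally $s$-minimal in $\Omega^\infty$. -/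

import Mathlib

open MeasureTheory Set Metric
open scoped ENNReal NNReal

noncomputable section

/-- The interaction functional `L_s(A, B) = ∫_A ∫_B |x - y|^{-(m + s)} dy dx` in `ℝ^m`, with values
in `[0, ∞]`. -/
def sInteraction {m : ℕ} (s : ℝ) (A B : Set (EuclideanSpace ℝ (Fin m))) : ℝ≥0∞ :=
  ∫⁻ x in A, ∫⁻ y in B, ENNReal.ofReal (1 / ‖x - y‖ ^ ((m : ℝ) + s))

/-- The fractional `s`-perimeter `P_s(E, U)` of `E ⊆ ℝ^m` in `U`. -/
def sPerimeter {m : ℕ} (s : ℝ) (E U : Set (EuclideanSpace ℝ (Fin m))) : ℝ≥0∞ :=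
  sInteraction s (E ∩ U) (Eᶜ ∩ U) + sInteraction s (E ∩ U) (Eᶜ \ U) +
    sInteraction s (E \ U) (Eᶜ ∩ U)

/-- `E` is `s`-minimal in `U`. Sets are Lebesgue measurable (that is, null measurable for `volume`)
and are compared up to Lebesgue null sets. -/
def IsSMinimal {m : ℕ} (s : ℝ) (E U : Set (EuclideanSpace ℝ (Fin m))) : Prop :=
  NullMeasurableSet E volume ∧ sPerimeter s E U < ∞ ∧
    ∀ F : Set (EuclideanSpace ℝ (Fin m)), NullMeasurableSet F volume →
      (F \ U : Set (EuclideanSpace ℝ (Fin m))) =ᵐ[volume]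
        (E \ U : Set (EuclideanSpace ℝ (Fin m))) →
      sPerimeter s E U ≤ sPerimeter s F U

/-- `A ⊂⊂ B`: the closure of `A` is compact and contained in `B`. -/
def CompactlyContained {X : Type*} [TopologicalSpace X] (A B : Set X) : Prop :=
  IsCompact (closure A) ∧ closure A ⊆ B

/-- `E` is locally `s`-minimal in `U`: it is `s`-minimal in every open `U' ⊂⊂ U`. -/
def IsLocallySMinimal {m : ℕ} (s : ℝ) (E U : Set (EuclideanSpace ℝ (Fin m))) : Prop :=
  ∀ U' : Set (EuclideanSpace ℝ (Fin m)), IsOpen U' → CompactlyContained U' U → IsSMinimal s E U'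

/-- `Ω ⊆ ℝ^n` has `C^{1,1}` boundary: near each boundary point, in suitable orthonormal coordinates
(with vertical direction `ν`), `Ω` is the region below the graph of a differentiable function with
Lipschitz gradient of the horizontal coordinates `x - ⟪x, ν⟫ ν`. -/
def HasC11Boundary {n : ℕ} (Ω : Set (EuclideanSpace ℝ (Fin n))) : Prop :=
  ∀ x₀ ∈ frontier Ω, ∃ r : ℝ, 0 < r ∧ ∃ ν : EuclideanSpace ℝ (Fin n), ‖ν‖ = 1 ∧
    ∃ φ : EuclideanSpace ℝ (Fin n) → ℝ, Differentiable ℝ φ ∧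
      (∃ K : ℝ≥0, LipschitzWith K (fderiv ℝ φ)) ∧
      ∀ x ∈ ball x₀ r, x ∈ Ω ↔ inner ℝ x ν < φ (x - (inner ℝ x ν : ℝ) • ν)

/-- The first `n` coordinates of a point of `ℝ^{n+1} = ℝ^n × ℝ`. -/
def baseCoord {n : ℕ} (X : EuclideanSpace ℝ (Fin (n + 1))) : EuclideanSpace ℝ (Fin n) :=
  WithLp.toLp 2 fun i => X i.castSucc

/-- The last coordinate of a point of `ℝ^{n+1} = ℝ^n × ℝ`. -/
def heightCoord {n : ℕ} (X : EuclideanSpace ℝ (Fin (n + 1))) : ℝ :=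
  X (Fin.last n)

/-- The product `Ω × I ⊆ ℝ^{n+1}` of `Ω ⊆ ℝ^n` and `I ⊆ ℝ`. -/
def cyl {n : ℕ} (Ω : Set (EuclideanSpace ℝ (Fin n))) (I : Set ℝ) :
    Set (EuclideanSpace ℝ (Fin (n + 1))) :=
  {X | baseCoord X ∈ Ω ∧ heightCoord X ∈ I}

/-- The subgraph `{(x, t) | t < v x} ⊆ ℝ^{n+1}` of `v : ℝ^n → ℝ`. -/
def subgraph {n : ℕ} (v : EuclideanSpace ℝ (Fin n) → ℝ) :
    Set (EuclideanSpace ℝ (Fin (n + 1))) :=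
  {X | heightCoord X < v (baseCoord X)}

/-- `M` is an a priori height bound for `s`, `Ω` and `v`: every set `E` that is locally `s`-minimal
in `Ω × ℝ` and coincides with the subgraph of `v` outside `Ω × ℝ` satisfies
`Ω × (-∞, -M] ⊆ E ∩ (Ω × ℝ) ⊆ Ω × (-∞, M]` and coincides with the subgraph of `v` outside
`Ω × [-M, M]` (everything up to null sets). -/
def IsHeightBound {n : ℕ} (s : ℝ) (Ω : Set (EuclideanSpace ℝ (Fin n)))
    (v : EuclideanSpace ℝ (Fin n) → ℝ) (M : ℝ) : Prop :=
  ∀ E : Set (EuclideanSpace ℝ (Fin (n + 1))),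
    NullMeasurableSet E volume →
    IsLocallySMinimal s E (cyl Ω univ) →
    (E \ cyl Ω univ : Set (EuclideanSpace ℝ (Fin (n + 1)))) =ᵐ[volume]
      (subgraph v \ cyl Ω univ : Set (EuclideanSpace ℝ (Fin (n + 1)))) →
    cyl Ω (Iic (-M)) ≤ᵐ[volume]
        (E ∩ cyl Ω univ : Set (EuclideanSpace ℝ (Fin (n + 1)))) ∧
      (E ∩ cyl Ω univ : Set (EuclideanSpace ℝ (Fin (n + 1)))) ≤ᵐ[volume]
        cyl Ω (Iic M) ∧
      (E \ cyl Ω (Icc (-M) M) : Set (EuclideanSpace ℝ (Fin (n + 1)))) =ᵐ[volume]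
        (subgraph v \ cyl Ω (Icc (-M) M) : Set (EuclideanSpace ℝ (Fin (n + 1))))

end

/-! For `U ⊆ V`, the perimeter in `V` is the perimeter in `U` plus a term that depends only on the
set outside `U` (`sPerimeter_eq_add`). Hence if `E` is minimal in `V`, `F` is minimal in `U` and
both agree outside `U`, then `F` has no more energy in `V` than `E` and is minimal there too
(`IsSMinimal.extend`). It therefore suffices to have one locally minimal `E` in the infinite
cylinder with datum `Sg(v)`: the height bound makes it agree with `F` outside `Ω^{k₀}`. That `E` is
minimal in the whole of each `Ω^k` is `IsLocallySMinimal.isSMinimal`: boundary layers of width `h`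
have volume `O(h)`, and gluing a competitor along a well-chosen level of the boundary distance costs
only `O(h^{1-s})`.

Height estimate. Let `A` be the part of `E` over `Ω` between heights `M` and `k`. Comparison with `E
\ A` shows that `A` interacts no more with `Eᶜ` than with `E \ A`. Reflection through the points of
`A` shows that the parts of `Aᶜ` above and below interact equally with `A`. Together, the
interaction of `A` with `Eᶜ` below is at most that with `E \ A` above (`sKernel_below_le_above`).
For large `M` the first is at least `2c|A|`, since beside the cylinder `E` is empty above the datum;
the second is at most `c|A|` plus the interaction with `E` over `Ω` above `k`
(`exists_truncation_constants`). When the datum prescribes emptiness there, `|A| = 0`. When `E` is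
minimal in every `Ω^k`, averaging over `k` bounds `|A|` by the volume of a slab of `E`, so the total
volume above `M` is first finite and then zero (`volume_above_eq_zero`). The lower bound is the same
statement for the complement, with the sign `σ = -1`.

Existence. Minimizers in `Ω^k` come from a convex relaxation in `L²` and a good superlevel set
(`exists_isSMinimal`). By the uniform height estimate, minimizers for different large `k` agree
outside one fixed cylinder, so the extension principle makes a single one locally minimal in the
infinite cylinder. -/

/-- The measure on pairs with density `|x - y|^{-(m + s)}`. -/
noncomputable def sKernel (m : ℕ) (s : ℝ) :
    Measure (EuclideanSpace ℝ (Fin m) × EuclideanSpace ℝ (Fin m)) :=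
  (volume.prod volume).withDensity fun z => ENNReal.ofReal (1 / ‖z.1 - z.2‖ ^ ((m : ℝ) + s))

/-! ### Perimeter as the measure of a set of pairs -/

section Kernel

variable {m : ℕ} {s : ℝ}

lemma measurable_sKernel_density :
    Measurable fun z : EuclideanSpace ℝ (Fin m) × EuclideanSpace ℝ (Fin m) =>
      ENNReal.ofReal (1 / ‖z.1 - z.2‖ ^ ((m : ℝ) + s)) := by
  fun_prop

instance : SFinite (sKernel m s) := by unfold sKernel; infer_instance

lemma sKernel_absolutelyContinuous :
    sKernel m s ≪ (volume : Measure (EuclideanSpace ℝ (Fin m))).prod volume :=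
  withDensity_absolutelyContinuous _ _

lemma sInteraction_eq_sKernel (A B : Set (EuclideanSpace ℝ (Fin m))) :
    sInteraction s A B = sKernel m s (A ×ˢ B) := by
  rw [sInteraction, sKernel, withDensity_apply', ← Measure.prod_restrict,
    lintegral_prod _ measurable_sKernel_density.aemeasurable]

lemma lintegral_sKernel (f : EuclideanSpace ℝ (Fin m) × EuclideanSpace ℝ (Fin m) → ℝ≥0∞)
    (hf : Measurable f) :
    ∫⁻ z, f z ∂(sKernel m s) =
      ∫⁻ x, ∫⁻ y, ENNReal.ofReal (1 / ‖x - y‖ ^ ((m : ℝ) + s)) * f (x, y) := by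
  rw [sKernel, lintegral_withDensity_eq_lintegral_mul _ measurable_sKernel_density hf,
    lintegral_prod _ (measurable_sKernel_density.mul hf).aemeasurable]
  rfl

lemma sKernel_apply {S : Set (EuclideanSpace ℝ (Fin m) × EuclideanSpace ℝ (Fin m))}
    (hS : MeasurableSet S) :
    sKernel m s S =
      ∫⁻ x, ∫⁻ y in Prod.mk x ⁻¹' S, ENNReal.ofReal (1 / ‖x - y‖ ^ ((m : ℝ) + s)) := by
  rw [← lintegral_indicator_one hS, lintegral_sKernel _ (measurable_one.indicator hS)]
  refine lintegral_congr fun x => ?_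
  rw [← lintegral_indicator (measurable_prodMk_left hS)]
  refine lintegral_congr fun y => ?_
  by_cases h : (x, y) ∈ S <;> simp [h, indicator]

lemma measurePreserving_swap_sKernel :
    MeasurePreserving Prod.swap (sKernel m s) (sKernel m s) := by
  refine ⟨measurable_swap, ?_⟩
  ext S hS
  rw [Measure.map_apply measurable_swap hS, sKernel, withDensity_apply _ hS,
    withDensity_apply _ (measurable_swap hS),
    ← (Measure.measurePreserving_swap (μ := (volume : Measure (EuclideanSpace ℝ (Fin m))))
      (ν := (volume : Measure (EuclideanSpace ℝ (Fin m))))).setLIntegral_comp_preimage hS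
        measurable_sKernel_density]
  simp [norm_sub_rev]

lemma sKernel_swap {S : Set (EuclideanSpace ℝ (Fin m) × EuclideanSpace ℝ (Fin m))}
    (hS : NullMeasurableSet S (sKernel m s)) :
    sKernel m s (Prod.swap ⁻¹' S) = sKernel m s S :=
  measurePreserving_swap_sKernel.measure_preimage hS

lemma nullMeasurableSet_prod_sKernel {A B : Set (EuclideanSpace ℝ (Fin m))}
    (hA : NullMeasurableSet A volume) (hB : NullMeasurableSet B volume) :
    NullMeasurableSet (A ×ˢ B) (sKernel m s) :=
  (hA.prod hB).mono_ac sKernel_absolutelyContinuous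

lemma sKernel_prod_comm {A B : Set (EuclideanSpace ℝ (Fin m))}
    (hA : NullMeasurableSet A volume) (hB : NullMeasurableSet B volume) :
    sKernel m s (A ×ˢ B) = sKernel m s (B ×ˢ A) := by
  rw [← sKernel_swap (nullMeasurableSet_prod_sKernel hB hA)]
  congr 1
  ext z
  simp

lemma ae_sKernel_fst {p : EuclideanSpace ℝ (Fin m) → Prop} (h : ∀ᵐ x, p x) :
    ∀ᵐ z ∂(sKernel m s), p z.1 :=
  sKernel_absolutelyContinuous.ae_le (Measure.quasiMeasurePreserving_fst.ae h)

lemma ae_sKernel_snd {p : EuclideanSpace ℝ (Fin m) → Prop} (h : ∀ᵐ x, p x) :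
    ∀ᵐ z ∂(sKernel m s), p z.2 :=
  sKernel_absolutelyContinuous.ae_le (Measure.quasiMeasurePreserving_snd.ae h)

/-- The three products are disjoint and together consist of the pairs in `E ×ˢ Eᶜ` with at least one
point in `U`. Comparisons of perimeters thus become comparisons of sets under a single measure. -/
lemma sPerimeter_eq_sKernel {E U : Set (EuclideanSpace ℝ (Fin m))}
    (hE : NullMeasurableSet E volume) (hU : NullMeasurableSet U volume) :
    sPerimeter s E U = sKernel m s ((E ×ˢ Eᶜ) \ (Uᶜ ×ˢ Uᶜ)) := by
  have h1 : (E ×ˢ Eᶜ) \ (Uᶜ ×ˢ Uᶜ) =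
      ((E ∩ U) ×ˢ (Eᶜ ∩ U) ∪ (E ∩ U) ×ˢ (Eᶜ \ U)) ∪ (E \ U) ×ˢ (Eᶜ ∩ U) := by
    ext z
    simp only [mem_sdiff, mem_prod, mem_compl_iff, mem_union, mem_inter_iff]
    tauto
  rw [h1, measure_union₀, measure_union₀, sPerimeter, sInteraction_eq_sKernel,
    sInteraction_eq_sKernel, sInteraction_eq_sKernel]
  · exact nullMeasurableSet_prod_sKernel (hE.inter hU) (hE.compl.diff hU)
  · refine Disjoint.aedisjoint (disjoint_left.2 fun z => ?_)
    simp only [mem_sdiff, mem_prod, mem_compl_iff, mem_inter_iff]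
    tauto
  · exact nullMeasurableSet_prod_sKernel (hE.diff hU) (hE.compl.inter hU)
  · refine Disjoint.aedisjoint (disjoint_left.2 fun z => ?_)
    simp only [mem_sdiff, mem_prod, mem_compl_iff, mem_union, mem_inter_iff]
    tauto

lemma nullMeasurableSet_sPerimeter_region {E U : Set (EuclideanSpace ℝ (Fin m))}
    (hE : NullMeasurableSet E volume) (hU : NullMeasurableSet U volume) :
    NullMeasurableSet ((E ×ˢ Eᶜ) \ (Uᶜ ×ˢ Uᶜ)) (sKernel m s) := by
  have h1 := nullMeasurableSet_prod_sKernel (s := s) hE hE.compl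
  have h2 := nullMeasurableSet_prod_sKernel (s := s) hU.compl hU.compl
  exact h1.diff h2

lemma sPerimeter_compl {E U : Set (EuclideanSpace ℝ (Fin m))}
    (hE : NullMeasurableSet E volume) (hU : NullMeasurableSet U volume) :
    sPerimeter s Eᶜ U = sPerimeter s E U := by
  rw [sPerimeter_eq_sKernel hE.compl hU, sPerimeter_eq_sKernel hE hU, ← sKernel_swap]
  · congr 1
    ext z
    simp only [mem_preimage, mem_sdiff, mem_prod, mem_compl_iff, Prod.fst_swap, Prod.snd_swap]
    tauto
  · exact nullMeasurableSet_sPerimeter_region hE.compl hU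

lemma sPerimeter_congr {E F U : Set (EuclideanSpace ℝ (Fin m))}
    (hE : NullMeasurableSet E volume) (hU : NullMeasurableSet U volume) (h : E =ᵐ[volume] F) :
    sPerimeter s E U = sPerimeter s F U := by
  rw [sPerimeter_eq_sKernel hE hU, sPerimeter_eq_sKernel (hE.congr h) hU]
  refine measure_congr (Filter.eventuallyEq_set.2 ?_)
  have h' := Filter.eventuallyEq_set.1 h
  filter_upwards [ae_sKernel_fst h', ae_sKernel_snd h'] with z h1 h2
  simp only [mem_sdiff, mem_prod, mem_compl_iff, h1, h2]

lemma sPerimeter_mono {E U V : Set (EuclideanSpace ℝ (Fin m))}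
    (hE : NullMeasurableSet E volume) (hU : NullMeasurableSet U volume)
    (hV : NullMeasurableSet V volume) (hUV : U ⊆ V) : sPerimeter s E U ≤ sPerimeter s E V := by
  rw [sPerimeter_eq_sKernel hE hU, sPerimeter_eq_sKernel hE hV]
  refine measure_mono (sdiff_subset_sdiff_right (prod_mono ?_ ?_)) <;>
    exact compl_subset_compl.2 hUV

lemma sPerimeter_le_sKernel {E U : Set (EuclideanSpace ℝ (Fin m))}
    (hE : NullMeasurableSet E volume) (hU : NullMeasurableSet U volume)
    (hEU : E ∩ U = ∅) : sPerimeter s E U ≤ sKernel m s (U ×ˢ Uᶜ) := by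
  rw [sPerimeter_eq_sKernel hE hU, sKernel_prod_comm hU hU.compl]
  refine measure_mono fun z hz => ?_
  have h1 : z.1 ∈ E → z.1 ∉ U := fun h h' => by
    have : z.1 ∈ E ∩ U := ⟨h, h'⟩
    simp [hEU] at this
  simp only [mem_sdiff, mem_prod, mem_compl_iff] at hz ⊢
  tauto

end Kernel

/-! ### Scaling of the truncated potential -/

section Potential

variable {m : ℕ} {s : ℝ}

/-- In polar coordinates the integrand is `r ^ (-s)` on `(0, 1]` and `r ^ (-1 - s)` beyond,
integrable because `s < 1` and `0 < s` respectively. -/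
lemma integrable_min_norm_mul_rpow (hm : 0 < m) (hs0 : 0 < s) (hs1 : s < 1) :
    Integrable (fun w : EuclideanSpace ℝ (Fin m) => min 1 ‖w‖ * (1 / ‖w‖ ^ ((m : ℝ) + s))) := by
  have : Nonempty (Fin m) := ⟨⟨0, hm⟩⟩
  refine (integrable_fun_norm_addHaar (volume : Measure (EuclideanSpace ℝ (Fin m)))
    (f := fun r => min 1 r * (1 / r ^ ((m : ℝ) + s)))).2 ?_
  have key : ∀ r : ℝ, 0 < r →
      r ^ (Module.finrank ℝ (EuclideanSpace ℝ (Fin m)) - 1) • (min 1 r * (1 / r ^ ((m : ℝ) + s)))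
        = min 1 r * r ^ (-1 - s) := by
    intro r hr
    rw [finrank_euclideanSpace_fin, smul_eq_mul, ← Real.rpow_natCast, Nat.cast_sub hm, one_div,
      ← Real.rpow_neg hr.le, mul_left_comm, ← Real.rpow_add hr]
    congr 2
    push_cast
    ring
  rw [← Ioc_union_Ioi_eq_Ioi (zero_le_one' ℝ)]
  refine IntegrableOn.union ?_ ?_
  · have h1 : IntegrableOn (fun r : ℝ => r ^ (-s)) (Ioc 0 1) :=
      (intervalIntegrable_iff_integrableOn_Ioc_of_le zero_le_one).1
        (intervalIntegral.intervalIntegrable_rpow' (by linarith))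
    refine h1.congr_fun (fun r hr => ?_) measurableSet_Ioc
    simp only
    rw [key r hr.1, min_eq_right hr.2]
    nth_rewrite 2 [← Real.rpow_one r]
    rw [← Real.rpow_add hr.1]
    congr 1
    ring
  · have h1 : IntegrableOn (fun r : ℝ => r ^ (-1 - s)) (Ioi 1) :=
      integrableOn_Ioi_rpow_of_lt (by linarith) one_pos
    refine h1.congr_fun (fun r hr => ?_) measurableSet_Ioi
    simp only
    rw [key r (one_pos.trans hr), min_eq_left (le_of_lt hr), one_mul]

lemma lintegral_comp_smul_pos {h : ℝ} (hh : 0 < h) (f : EuclideanSpace ℝ (Fin m) → ℝ≥0∞)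
    (hf : Measurable f) :
    ∫⁻ w, f w = ENNReal.ofReal (h ^ m) * ∫⁻ w, f (h • w) := by
  have h1 : ∫⁻ w, f (h • w) = ∫⁻ w, f w ∂(Measure.map (h • ·) volume) :=
    (lintegral_map hf (measurable_const_smul h)).symm
  rw [h1, Measure.map_addHaar_smul _ hh.ne', lintegral_smul_measure, finrank_euclideanSpace_fin,
    smul_eq_mul, ← mul_assoc, ← ENNReal.ofReal_mul (by positivity), abs_of_pos (by positivity),
    mul_inv_cancel₀ (by positivity), ENNReal.ofReal_one, one_mul]

/-- The truncated Riesz-type potential scales like `h ^ (1 - s)`. -/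
lemma exists_potential_bound (hm : 0 < m) (hs0 : 0 < s) (hs1 : s < 1) :
    ∃ C : ℝ≥0, ∀ h : ℝ, 0 < h →
      ∫⁻ w : EuclideanSpace ℝ (Fin m),
        ENNReal.ofReal (1 / ‖w‖ ^ ((m : ℝ) + s)) * ENNReal.ofReal (min h ‖w‖)
          ≤ C * ENNReal.ofReal (h ^ (1 - s)) := by
  have h1 := (integrable_min_norm_mul_rpow hm hs0 hs1).lintegral_lt_top
  lift (∫⁻ w : EuclideanSpace ℝ (Fin m),
    ENNReal.ofReal (min 1 ‖w‖ * (1 / ‖w‖ ^ ((m : ℝ) + s)))) to ℝ≥0 using h1.ne with C hC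
  refine ⟨C, fun h hh => le_of_eq ?_⟩
  rw [lintegral_comp_smul_pos hh _ (by fun_prop), hC, mul_comm (lintegral _ _),
    ← lintegral_const_mul' _ _ ENNReal.ofReal_ne_top,
    ← lintegral_const_mul' _ _ ENNReal.ofReal_ne_top]
  refine lintegral_congr fun w => ?_
  rw [norm_smul, Real.norm_of_nonneg hh.le, ← ENNReal.ofReal_mul (by positivity),
    ← ENNReal.ofReal_mul (by positivity), ← ENNReal.ofReal_mul (by positivity)]
  congr 1
  rw [Real.mul_rpow hh.le (norm_nonneg _)]
  have h2 : min h (h * ‖w‖) = h * min 1 ‖w‖ := by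
    rw [mul_min_of_nonneg _ _ hh.le, mul_one]
  have h3 : h ^ m * h = h ^ (1 - s) * h ^ ((m : ℝ) + s) := by
    rw [← Real.rpow_add hh, ← pow_succ, ← Real.rpow_natCast]
    congr 1
    push_cast
    ring
  have h4 : h ^ ((m : ℝ) + s) ≠ 0 := (Real.rpow_pos_of_pos hh _).ne'
  rw [h2, one_div, mul_inv]
  calc h ^ m * ((h ^ ((m : ℝ) + s))⁻¹ * (‖w‖ ^ ((m : ℝ) + s))⁻¹ * (h * min 1 ‖w‖))
      = (h ^ m * h) * (h ^ ((m : ℝ) + s))⁻¹ * (min 1 ‖w‖ * (‖w‖ ^ ((m : ℝ) + s))⁻¹) := by ring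
    _ = _ := by rw [h3, mul_assoc (h ^ (1 - s)), mul_inv_cancel₀ h4, mul_one, one_div]

end Potential

/-! ### Averaging over level sets -/

section Average

variable {X : Type*} [MeasurableSpace X]

lemma measurableSet_levelSet {f : X → ℝ} (hf : Measurable f) :
    MeasurableSet {q : ℝ × (X × X) | f q.2.2 ≤ q.1 ∧ q.1 < f q.2.1} := by
  have h1 : MeasurableSet {q : ℝ × (X × X) | f q.2.2 ≤ q.1} :=
    measurableSet_le (by fun_prop) (by fun_prop)
  have h2 : MeasurableSet {q : ℝ × (X × X) | q.1 < f q.2.1} :=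
    measurableSet_lt (by fun_prop) (by fun_prop)
  exact h1.inter h2

lemma lintegral_measure_levelSet (ν : Measure (X × X)) [SFinite ν] {f : X → ℝ} (hf : Measurable f)
    (W : Set (X × X)) (h : ℝ) :
    ∫⁻ c in Ioo 0 h, ν (W ∩ {z | f z.2 ≤ c ∧ c < f z.1}) =
      ∫⁻ z in W, volume (Ioo 0 h ∩ Ico (f z.2) (f z.1)) ∂ν := by
  have hS := measurableSet_levelSet hf
  have h1 := Measure.prod_apply (μ := volume.restrict (Ioo 0 h)) (ν := ν.restrict W) hS
  rw [Measure.prod_apply_symm hS] at h1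
  refine Eq.trans ?_ (h1.symm.trans ?_)
  · refine lintegral_congr fun c => ?_
    rw [Measure.restrict_apply (measurable_prodMk_left hS), inter_comm]
    rfl
  · refine lintegral_congr fun z => ?_
    rw [Measure.restrict_apply (measurable_prodMk_right hS), inter_comm]
    rfl

/-- Some level does no worse than the mean over `(0, h)`, and by Tonelli the mean is governed by the
length of the set of levels separating the two values of `f`. This plays the role of the coarea
formula. -/
lemma exists_levelSet_le (ν : Measure (X × X)) [SFinite ν] {f : X → ℝ} (hf : Measurable f)
    {W : Set (X × X)} (hW : MeasurableSet W) {h : ℝ} (hh : 0 < h) :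
    ∃ c ∈ Ioo 0 h, ENNReal.ofReal h * ν (W ∩ {z | f z.2 ≤ c ∧ c < f z.1}) ≤
      ∫⁻ z in W, volume (Ioo 0 h ∩ Ico (f z.2) (f z.1)) ∂ν := by
  have hS := measurableSet_levelSet hf
  have hm : Measurable fun c : ℝ => ν (W ∩ {z | f z.2 ≤ c ∧ c < f z.1}) := by
    have := measurable_measure_prodMk_left (ν := ν) ((measurable_snd hW).inter hS)
    exact this
  have hv : volume (Ioo 0 h) = ENNReal.ofReal h := by simp
  obtain ⟨c, hc, hle⟩ := exists_le_setLAverage (μ := volume) (s := Ioo 0 h)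
    (by simp [hv, hh]) (by simp [hv]) hm.aemeasurable
  refine ⟨c, hc, ?_⟩
  rw [setLAverage_eq, lintegral_measure_levelSet ν hf W, hv,
    ENNReal.le_div_iff_mul_le (by simp [hh]) (by simp), mul_comm] at hle
  exact hle

end Average

/-! ### Distant interactions and cheap cuts -/

section KernelBound

variable {m : ℕ} {s : ℝ} {C : ℝ≥0}

/-- `C` bounds the potential of the truncated distance at every scale. -/
def SKernelBound (m : ℕ) (s : ℝ) (C : ℝ≥0) : Prop :=
  ∀ h : ℝ, 0 < h → ∀ B : Set (EuclideanSpace ℝ (Fin m)), MeasurableSet B →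
    ∫⁻ z in Prod.fst ⁻¹' B, ENNReal.ofReal (min h ‖z.1 - z.2‖) ∂(sKernel m s) ≤
      C * ENNReal.ofReal (h ^ (1 - s)) * volume B

lemma exists_sKernelBound (hm : 0 < m) (hs0 : 0 < s) (hs1 : s < 1) :
    ∃ C : ℝ≥0, SKernelBound m s C := by
  obtain ⟨C, hC⟩ := exists_potential_bound hm hs0 hs1
  refine ⟨C, fun h hh B hB => ?_⟩
  have hB' : MeasurableSet (Prod.fst ⁻¹' B :
      Set (EuclideanSpace ℝ (Fin m) × EuclideanSpace ℝ (Fin m))) := measurable_fst hB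
  rw [← lintegral_indicator hB', lintegral_sKernel _ (Measurable.indicator (by fun_prop) hB'),
    ← setLIntegral_const, ← lintegral_indicator hB]
  refine lintegral_mono fun x => ?_
  by_cases hx : x ∈ B
  · rw [indicator_of_mem hx]
    refine le_trans (le_of_eq ?_) (hC h hh)
    rw [← lintegral_sub_left_eq_self _ x]
    refine lintegral_congr fun y => ?_
    rw [indicator_of_mem (by exact hx)]
    simp only [sub_sub_cancel]
  · rw [indicator_of_notMem hx]
    refine le_of_eq ?_
    rw [← lintegral_zero (α := EuclideanSpace ℝ (Fin m)) (μ := volume)]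
    refine lintegral_congr fun y => ?_
    rw [indicator_of_notMem (by exact hx), mul_zero]

lemma ofReal_rpow_one_sub {h : ℝ} (hh : 0 < h) :
    ENNReal.ofReal (h ^ (1 - s)) = ENNReal.ofReal h * ENNReal.ofReal (h ^ (-s)) := by
  rw [← ENNReal.ofReal_mul hh.le, sub_eq_add_neg, Real.rpow_add hh, Real.rpow_one]

lemma SKernelBound.of_mul_le (hC : SKernelBound m s C) {h : ℝ} (hh : 0 < h) {a : ℝ≥0∞}
    {B : Set (EuclideanSpace ℝ (Fin m))} (hB : MeasurableSet B)
    (ha : ENNReal.ofReal h * a ≤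
      ∫⁻ z in Prod.fst ⁻¹' B, ENNReal.ofReal (min h ‖z.1 - z.2‖) ∂(sKernel m s)) :
    a ≤ C * ENNReal.ofReal (h ^ (-s)) * volume B := by
  have h1 := ha.trans (hC h hh B hB)
  rw [ofReal_rpow_one_sub hh, mul_left_comm, mul_assoc] at h1
  exact (ENNReal.mul_le_mul_iff_right (by simpa using hh) ENNReal.ofReal_ne_top).1 h1

/-- Markov's inequality: at distance at least `ρ`, the truncated distance `min ρ ‖z.1 - z.2‖` equals
`ρ`. -/
lemma SKernelBound.far (hC : SKernelBound m s C) {ρ : ℝ} (hρ : 0 < ρ)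
    {A : Set (EuclideanSpace ℝ (Fin m))} (hA : MeasurableSet A) :
    sKernel m s {z | z.1 ∈ A ∧ ρ ≤ ‖z.1 - z.2‖} ≤ C * ENNReal.ofReal (ρ ^ (-s)) * volume A := by
  refine hC.of_mul_le hρ hA ?_
  have hA' : MeasurableSet (Prod.fst ⁻¹' A :
      Set (EuclideanSpace ℝ (Fin m) × EuclideanSpace ℝ (Fin m))) := measurable_fst hA
  refine le_trans ?_ (mul_meas_ge_le_lintegral
    (μ := (sKernel m s).restrict (Prod.fst ⁻¹' A)) (by fun_prop) (ENNReal.ofReal ρ))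
  rw [Measure.restrict_apply' hA']
  gcongr
  rintro z ⟨hz1, hz2⟩
  exact ⟨by simp only [mem_ofPred_eq]; rw [min_eq_left hz2], hz1⟩

/-- As `f` is 1-Lipschitz, the levels in `(0, h)` separating two points have length at most `min h
‖x - y‖`, so a level of average cost is cheap. It serves to cut along a level of the boundary
distance or of the height. -/
lemma SKernelBound.exists_level (hC : SKernelBound m s C) {f : EuclideanSpace ℝ (Fin m) → ℝ}
    (hf : LipschitzWith 1 f) {B : Set (EuclideanSpace ℝ (Fin m))} (hB : MeasurableSet B)
    {h : ℝ} (hh : 0 < h) :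
    ∃ c ∈ Ioo 0 h, sKernel m s ({x | c < f x} ×ˢ (B ∩ {y | f y ≤ c})) ≤
      C * ENNReal.ofReal (h ^ (-s)) * volume (B ∩ {y | f y ≤ h}) := by
  have hfm : Measurable f := hf.continuous.measurable
  have hB2 : MeasurableSet (B ∩ {y | f y ≤ h}) := hB.inter (measurableSet_le hfm measurable_const)
  obtain ⟨c, hc, hle⟩ := exists_levelSet_le (sKernel m s) hfm (measurable_snd hB2) hh
  refine ⟨c, hc, hC.of_mul_le hh hB2 (le_trans ?_ (hle.trans ?_))⟩
  · gcongr
    rintro z ⟨hz1, hz2, hz3⟩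
    exact ⟨⟨hz2, le_trans hz3 hc.2.le⟩, hz3, hz1⟩
  · rw [← measurePreserving_swap_sKernel.setLIntegral_comp_preimage (measurable_fst hB2)
      (by fun_prop)]
    refine lintegral_mono fun z => ?_
    rw [ENNReal.ofReal_mono.map_min]
    refine le_min ((measure_mono inter_subset_left).trans (by simp))
      ((measure_mono inter_subset_right).trans ?_)
    rw [Real.volume_Ico]
    refine ENNReal.ofReal_le_ofReal ((le_abs_self _).trans ?_)
    have := hf.dist_le_mul z.1 z.2
    rwa [NNReal.coe_one, one_mul, Real.dist_eq, dist_eq_norm, norm_sub_rev] at this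

end KernelBound

/-! ### Minimality in nested domains -/

section Minimality

variable {m : ℕ} {s : ℝ} {E F U V A : Set (EuclideanSpace ℝ (Fin m))}

lemma diff_ae_eq_iff {X : Type*} [MeasurableSpace X] {μ : Measure X} {E F U : Set X} :
    (E \ U : Set X) =ᵐ[μ] (F \ U : Set X) ↔ ∀ᵐ x ∂μ, x ∉ U → (x ∈ E ↔ x ∈ F) := by
  rw [Filter.eventuallyEq_set]
  refine Filter.eventually_congr (Filter.Eventually.of_forall fun x => ?_)
  simp only [mem_sdiff]
  tauto

/-- The remainder consists of pairs with both points outside `U`, so it is the same for all sets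
with the same exterior datum. This is what moves minimality between nested domains. -/
lemma sPerimeter_eq_add (hE : NullMeasurableSet E volume) (hU : NullMeasurableSet U volume)
    (hV : NullMeasurableSet V volume) (hUV : U ⊆ V) :
    sPerimeter s E V =
      sPerimeter s E U + sKernel m s (((E \ U) ×ˢ (Eᶜ \ U)) \ (Vᶜ ×ˢ Vᶜ)) := by
  rw [sPerimeter_eq_sKernel hE hU, sPerimeter_eq_sKernel hE hV, ← measure_union₀]
  · congr 1
    ext z
    have h1 := @hUV z.1
    have h2 := @hUV z.2
    simp only [mem_sdiff, mem_prod, mem_compl_iff, mem_union]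
    tauto
  · have h1 := nullMeasurableSet_prod_sKernel (s := s) (hE.diff hU) (hE.compl.diff hU)
    have h2 := nullMeasurableSet_prod_sKernel (s := s) hV.compl hV.compl
    exact h1.diff h2
  · refine Disjoint.aedisjoint (disjoint_left.2 fun z => ?_)
    simp only [mem_sdiff, mem_prod, mem_compl_iff]
    tauto

lemma sKernel_remainder_congr (h : (E \ U : Set _) =ᵐ[volume] (F \ U : Set _)) :
    sKernel m s (((E \ U) ×ˢ (Eᶜ \ U)) \ (Vᶜ ×ˢ Vᶜ)) =
      sKernel m s (((F \ U) ×ˢ (Fᶜ \ U)) \ (Vᶜ ×ˢ Vᶜ)) := by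
  refine measure_congr (Filter.eventuallyEq_set.2 ?_)
  rw [diff_ae_eq_iff] at h
  filter_upwards [ae_sKernel_fst h, ae_sKernel_snd h] with z h1 h2
  simp only [mem_sdiff, mem_prod, mem_compl_iff]
  tauto

lemma IsSMinimal.congr (hE : IsSMinimal s E U) (hU : NullMeasurableSet U volume)
    (h : E =ᵐ[volume] F) : IsSMinimal s F U := by
  obtain ⟨h1, h2, h3⟩ := hE
  refine ⟨h1.congr h, by rwa [← sPerimeter_congr h1 hU h], fun G hG hGF => ?_⟩
  rw [← sPerimeter_congr h1 hU h]
  exact h3 G hG (hGF.trans (h.symm.diff (ae_eq_refl U)))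

lemma IsSMinimal.restrict (hE : IsSMinimal s E V) (hU : NullMeasurableSet U volume)
    (hV : NullMeasurableSet V volume) (hUV : U ⊆ V) : IsSMinimal s E U := by
  obtain ⟨h1, h2, h3⟩ := hE
  refine ⟨h1, (sPerimeter_mono h1 hU hV hUV).trans_lt h2, fun G hG hGE => ?_⟩
  have h4 := h3 G hG (by
    rw [diff_ae_eq_iff] at hGE ⊢
    filter_upwards [hGE] with x hx hxV
    exact hx fun h => hxV (hUV h))
  rw [sPerimeter_eq_add h1 hU hV hUV, sPerimeter_eq_add hG hU hV hUV,
    sKernel_remainder_congr hGE] at h4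
  rw [sPerimeter_eq_add h1 hU hV hUV] at h2
  exact (ENNReal.add_le_add_iff_right (ENNReal.add_lt_top.1 h2).2.ne).1 h4

/-- Two minimizers in `U` with the same exterior datum are minimizers in the same larger sets. -/
lemma IsSMinimal.extend (hE : IsSMinimal s E V) (hF : IsSMinimal s F U)
    (hU : NullMeasurableSet U volume) (hV : NullMeasurableSet V volume) (hUV : U ⊆ V)
    (hEF : (E \ U : Set _) =ᵐ[volume] (F \ U : Set _)) : IsSMinimal s F V := by
  have hle : sPerimeter s F V ≤ sPerimeter s E V := by
    rw [sPerimeter_eq_add hE.1 hU hV hUV, sPerimeter_eq_add hF.1 hU hV hUV,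
      sKernel_remainder_congr hEF]
    gcongr
    exact hF.2.2 E hE.1 hEF
  refine ⟨hF.1, hle.trans_lt hE.2.1, fun G hG hGF => hle.trans (hE.2.2 G hG ?_)⟩
  rw [diff_ae_eq_iff] at hGF hEF ⊢
  filter_upwards [hGF, hEF] with x h1 h2 hx
  rw [h1 hx, h2 fun h => hx (hUV h)]

lemma IsSMinimal.compl (hE : IsSMinimal s E U) (hU : NullMeasurableSet U volume) :
    IsSMinimal s Eᶜ U := by
  obtain ⟨h1, h2, h3⟩ := hE
  refine ⟨h1.compl, by rwa [sPerimeter_compl h1 hU], fun G hG hGE => ?_⟩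
  rw [sPerimeter_compl h1 hU, ← sPerimeter_compl hG hU]
  refine h3 _ hG.compl ?_
  rw [diff_ae_eq_iff] at hGE ⊢
  filter_upwards [hGE] with x hx hxU
  simp [hx hxU]

/-- Removing a piece `A` from a minimizer does not decrease the perimeter. -/
lemma IsSMinimal.sKernel_prod_compl_le (hE : IsSMinimal s E U) (hU : NullMeasurableSet U volume)
    (hA : NullMeasurableSet A volume) (hAE : A ⊆ E) (hAU : A ⊆ U) :
    sKernel m s (A ×ˢ Eᶜ) ≤ sKernel m s (A ×ˢ (E \ A)) ∧ sKernel m s (A ×ˢ Eᶜ) < ∞ := by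
  obtain ⟨h1, h2, h3⟩ := hE
  have h4 := h3 (E \ A) (h1.diff hA) (by
    rw [diff_ae_eq_iff]
    refine Filter.Eventually.of_forall fun x hx => ?_
    have := @hAU x
    simp only [mem_sdiff]
    tauto)
  -- Both perimeters contain the same pairs from `(E \ A) ×ˢ Eᶜ`; finiteness of the perimeter of `E`
  -- allows this common part to be cancelled.
  have e1 : sPerimeter s E U = sKernel m s (A ×ˢ Eᶜ) +
      sKernel m s (((E \ A) ×ˢ Eᶜ) \ (Uᶜ ×ˢ Uᶜ)) := by
    rw [sPerimeter_eq_sKernel h1 hU, ← measure_union₀']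
    · congr 1
      ext z
      have := @hAE z.1
      have := @hAU z.1
      simp only [mem_sdiff, mem_prod, mem_compl_iff, mem_union]
      tauto
    · exact nullMeasurableSet_prod_sKernel hA h1.compl
    · refine Disjoint.aedisjoint (disjoint_left.2 fun z => ?_)
      simp only [mem_sdiff, mem_prod, mem_compl_iff]
      tauto
  have e2 : sPerimeter s (E \ A) U = sKernel m s (A ×ˢ (E \ A)) +
      sKernel m s (((E \ A) ×ˢ Eᶜ) \ (Uᶜ ×ˢ Uᶜ)) := by
    rw [sPerimeter_eq_sKernel (h1.diff hA) hU, sKernel_prod_comm hA (h1.diff hA),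
      ← measure_union₀']
    · congr 1
      ext z
      have := @hAE z.2
      have := @hAU z.2
      simp only [mem_sdiff, mem_prod, mem_compl_iff, mem_union]
      tauto
    · exact nullMeasurableSet_prod_sKernel (h1.diff hA) hA
    · refine Disjoint.aedisjoint (disjoint_left.2 fun z => ?_)
      have := @hAE z.2
      simp only [mem_sdiff, mem_prod, mem_compl_iff]
      tauto
  rw [e1] at h2
  rw [e1, e2] at h4
  exact ⟨(ENNReal.add_le_add_iff_right (ENNReal.add_lt_top.1 h2).2.ne).1 h4,
    (ENNReal.add_lt_top.1 h2).1⟩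

lemma IsSMinimal.isLocallySMinimal_of_exhaustion {U : Set (EuclideanSpace ℝ (Fin m))}
    {W : ℕ → Set (EuclideanSpace ℝ (Fin m))} (hW : ∀ j, NullMeasurableSet (W j) volume)
    (hE : ∀ j, IsSMinimal s E (W j))
    (hcov : ∀ K : Set (EuclideanSpace ℝ (Fin m)), IsCompact K → K ⊆ U → ∃ j, K ⊆ W j) :
    IsLocallySMinimal s E U := by
  intro U' hU' hc
  obtain ⟨j, hj⟩ := hcov _ hc.1 hc.2
  exact (hE j).restrict hU'.measurableSet.nullMeasurableSet (hW j) (subset_closure.trans hj)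

end Minimality

/-! ### A Hilbert space substitute for weak compactness -/

section Nested

/-- Decreasing closed midpoint-convex subsets of a Hilbert space that all meet a fixed ball have a
common point. -/
lemma exists_mem_of_antitone_midpoint_convex {H : Type*} [NormedAddCommGroup H]
    [InnerProductSpace ℝ H] [CompleteSpace H] {K : ℕ → Set H} (hanti : Antitone K)
    (hcl : ∀ j, IsClosed (K j))
    (hmid : ∀ j, ∀ u ∈ K j, ∀ w ∈ K j, (1 / 2 : ℝ) • (u + w) ∈ K j) {R : ℝ}
    (hR : ∀ j, ∃ u ∈ K j, ‖u‖ ≤ R) : ∃ u, ∀ j, u ∈ K j := by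
  have hne : ∀ j, (K j).Nonempty := fun j => (hR j).imp fun u hu => hu.1
  set r : ℕ → ℝ := fun j => infDist 0 (K j) with hr
  have hrmono : Monotone r := fun i j hij => infDist_le_infDist_of_subset (hanti hij) (hne j)
  have hrR : ∀ j, r j ≤ R := fun j => by
    obtain ⟨u, hu, huR⟩ := hR j
    exact (infDist_le_dist_of_mem hu).trans (by simpa using huR)
  obtain ⟨l, hl⟩ : ∃ l, Filter.Tendsto r Filter.atTop (nhds l) :=
    ⟨_, tendsto_atTop_ciSup hrmono ⟨R, by rintro _ ⟨j, rfl⟩; exact hrR j⟩⟩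
  have hrl : ∀ j, r j ≤ l := fun j => hrmono.ge_of_tendsto hl j
  have hr0 : ∀ j, 0 ≤ r j := fun j => infDist_nonneg
  have hex : ∀ j : ℕ, ∃ u ∈ K j, ‖u‖ < r j + 1 / ((j : ℝ) + 1) := fun j => by
    obtain ⟨u, hu, hu'⟩ := (infDist_lt_iff (x := (0 : H)) (hne j)).1
      (show r j < r j + 1 / ((j : ℝ) + 1) by linarith [Nat.one_div_pos_of_nat (α := ℝ) (n := j)])
    exact ⟨u, hu, by simpa using hu'⟩
  choose u huK hu using hex
  have hnorm : ∀ N j, N ≤ j → ‖u j‖ ≤ l + 1 / ((N : ℝ) + 1) := fun N j hNj => by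
    have := hu j
    have := hrl j
    have := Nat.one_div_le_one_div (α := ℝ) hNj
    linarith
  have hb : Filter.Tendsto (fun N : ℕ => √(4 * (l + 1 / ((N : ℝ) + 1)) ^ 2 - 4 * r N ^ 2))
      Filter.atTop (nhds 0) := by
    have h1 : Filter.Tendsto (fun N : ℕ => √(4 * (l + 1 / ((N : ℝ) + 1)) ^ 2 - 4 * r N ^ 2))
        Filter.atTop (nhds √(4 * (l + 0) ^ 2 - 4 * l ^ 2)) :=
      (((((tendsto_const_nhds.add tendsto_one_div_add_atTop_nhds_zero_nat).pow 2).const_mul 4).sub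
        ((hl.pow 2).const_mul 4))).sqrt
    simpa using h1
  have hcau : CauchySeq u := by
    refine cauchySeq_of_le_tendsto_0 _ (fun i j N hi hj => ?_) hb
    rw [dist_eq_norm]
    refine Real.le_sqrt_of_sq_le ?_
    -- The midpoint of `u i` and `u j` lies in `K N`, so its norm is at least `r N`, while both
    -- points have norm at most `l + 1 / (N + 1)`. The parallelogram law then forces them together.
    have hpar := parallelogram_law_with_norm ℝ (u i) (u j)
    have h1 : r N ≤ ‖(1 / 2 : ℝ) • (u i + u j)‖ := by
      have := infDist_le_dist_of_mem (x := (0 : H))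
        (hmid N _ (hanti hi (huK i)) _ (hanti hj (huK j)))
      rwa [dist_zero_left] at this
    rw [norm_smul, Real.norm_of_nonneg (by norm_num)] at h1
    have h2 := hnorm N i hi
    have h3 := hnorm N j hj
    have h4 := pow_le_pow_left₀ (norm_nonneg _) h2 2
    have h5 := pow_le_pow_left₀ (norm_nonneg _) h3 2
    have h6 := pow_le_pow_left₀ (hr0 N) h1 2
    nlinarith
  obtain ⟨w, hw⟩ := cauchySeq_tendsto_of_complete hcau
  refine ⟨w, fun j => (hcl j).mem_of_tendsto hw ?_⟩
  filter_upwards [Filter.eventually_ge_atTop j] with i hi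
  exact hanti hi (huK i)

end Nested

/-! ### Existence of minimizers by convex relaxation -/

section Relaxed

variable {m : ℕ} {s : ℝ}

/-- The convex relaxation of the fractional perimeter in `U`. -/
noncomputable def sVariation (s : ℝ) (U : Set (EuclideanSpace ℝ (Fin m)))
    (u : EuclideanSpace ℝ (Fin m) → ℝ) : ℝ≥0∞ :=
  ∫⁻ z in (Uᶜ ×ˢ Uᶜ)ᶜ, ENNReal.ofReal (u z.1 - u z.2) ∂(sKernel m s)

variable {E U : Set (EuclideanSpace ℝ (Fin m))} {u w : EuclideanSpace ℝ (Fin m) → ℝ}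

lemma sVariation_congr (h : u =ᵐ[volume] w) : sVariation s U u = sVariation s U w := by
  refine lintegral_congr_ae (ae_restrict_of_ae ?_)
  filter_upwards [ae_sKernel_fst h, ae_sKernel_snd h] with z h1 h2
  rw [h1, h2]

lemma sVariation_indicator (hE : MeasurableSet E) (hU : MeasurableSet U) :
    sVariation s U (E.indicator 1) = sPerimeter s E U := by
  have hm : MeasurableSet (E ×ˢ Eᶜ) := hE.prod hE.compl
  rw [sPerimeter_eq_sKernel hE.nullMeasurableSet hU.nullMeasurableSet, sdiff_eq,
    ← Measure.restrict_apply hm, ← lintegral_indicator_one hm, sVariation]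
  refine lintegral_congr fun z => ?_
  by_cases h1 : z.1 ∈ E <;> by_cases h2 : z.2 ∈ E <;> simp [indicator, h1, h2]

/-- The positive part is subadditive and positively homogeneous, so the functional is convex. -/
lemma sVariation_midpoint (hu : Measurable u) (hw : Measurable w) {b : ℝ≥0∞}
    (hub : sVariation s U u ≤ b) (hwb : sVariation s U w ≤ b) :
    sVariation s U (fun x => 1 / 2 * (u x + w x)) ≤ b := by
  have h1 : sVariation s U (fun x => 1 / 2 * (u x + w x)) ≤
      ENNReal.ofReal (1 / 2) * (sVariation s U u + sVariation s U w) := by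
    rw [sVariation, sVariation, sVariation, ← lintegral_add_left (by fun_prop),
      ← lintegral_const_mul _ (by fun_prop)]
    refine lintegral_mono fun z => ?_
    have : 1 / 2 * (u z.1 + w z.1) - 1 / 2 * (u z.2 + w z.2) =
      1 / 2 * ((u z.1 - u z.2) + (w z.1 - w z.2)) := by ring
    simp only [this]
    rw [ENNReal.ofReal_mul (by norm_num)]
    gcongr
    exact ENNReal.ofReal_add_le
  refine h1.trans ((mul_le_mul_right (add_le_add hub hwb) _).trans (le_of_eq ?_))
  rw [← two_mul, ← mul_assoc, ENNReal.ofReal_div_of_pos two_pos, ENNReal.ofReal_one,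
    ENNReal.ofReal_ofNat, one_div, ENNReal.inv_mul_cancel (by simp) (by simp), one_mul]

/-- Fatou's lemma. Along almost everywhere convergent subsequences it makes sublevel sets closed in
`L²`. -/
lemma sVariation_le_of_tendsto {f : ℕ → EuclideanSpace ℝ (Fin m) → ℝ}
    (hf : ∀ j, Measurable (f j))
    (hlim : ∀ᵐ x, Filter.Tendsto (fun j => f j x) Filter.atTop (nhds (u x))) {b : ℝ≥0∞}
    (hb : ∀ j, sVariation s U (f j) ≤ b) : sVariation s U u ≤ b := by
  have h1 : sVariation s U u =
      ∫⁻ z in (Uᶜ ×ˢ Uᶜ)ᶜ, Filter.liminf (fun j => ENNReal.ofReal (f j z.1 - f j z.2))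
        Filter.atTop ∂(sKernel m s) := by
    refine lintegral_congr_ae (ae_restrict_of_ae ?_)
    filter_upwards [ae_sKernel_fst hlim, ae_sKernel_snd hlim] with z h1 h2
    exact ((ENNReal.continuous_ofReal.tendsto _).comp (h1.sub h2)).liminf_eq.symm
  rw [h1]
  refine (lintegral_liminf_le fun j => by have := hf j; fun_prop).trans ?_
  refine (Filter.liminf_le_liminf (Filter.Eventually.of_forall hb)).trans ?_
  simp

open Classical in
/-- A function on `U` extended by the indicator function of `E` outside `U`. -/
noncomputable def extendByIndicator (U E : Set (EuclideanSpace ℝ (Fin m)))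
    (u : EuclideanSpace ℝ (Fin m) → ℝ) : EuclideanSpace ℝ (Fin m) → ℝ :=
  U.piecewise u (E.indicator 1)

lemma measurable_extendByIndicator (hU : MeasurableSet U) (hE : MeasurableSet E)
    (hu : Measurable u) : Measurable (extendByIndicator U E u) := by
  classical
  exact Measurable.piecewise hU hu (measurable_one.indicator hE)

/-- The length of the levels in `(0, 1)` separating two values of `u` is at most the positive part
of their difference; no bound on the values of `u` is needed. -/
lemma exists_superlevel_sPerimeter_le (hU : MeasurableSet U) (hu : Measurable u) :
    ∃ c ∈ Ioo (0 : ℝ) 1, sPerimeter s {x | c < u x} U ≤ sVariation s U u := by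
  obtain ⟨c, hc, hle⟩ := exists_levelSet_le (sKernel m s) hu (hU.compl.prod hU.compl).compl one_pos
  refine ⟨c, hc, ?_⟩
  have hm : MeasurableSet {x | c < u x} := measurableSet_lt measurable_const hu
  rw [sPerimeter_eq_sKernel hm.nullMeasurableSet hU.nullMeasurableSet]
  rw [ENNReal.ofReal_one, one_mul] at hle
  refine le_trans (le_of_eq ?_) (hle.trans (lintegral_mono fun z => ?_))
  · congr 1
    ext z
    simp only [mem_sdiff, mem_prod, mem_compl_iff, mem_inter_iff, mem_ofPred_eq, not_lt]
    tauto
  · exact (measure_mono inter_subset_right).trans (by rw [Real.volume_Ico])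

/-- Existence of `s`-minimal sets with prescribed exterior datum. -/
lemma exists_isSMinimal (hU : MeasurableSet U) (hUfin : volume U < ∞)
    (hUκ : sKernel m s (U ×ˢ Uᶜ) < ∞) (hE : MeasurableSet E) :
    ∃ F, IsSMinimal s F U ∧ (F \ U : Set _) =ᵐ[volume] (E \ U : Set _) := by
  classical
  have hfin : IsFiniteMeasure (volume.restrict U) := ⟨by simpa using hUfin⟩
  set S : Set ℝ≥0∞ := {p | ∃ F, MeasurableSet F ∧ (∀ᵐ x, x ∉ U → (x ∈ F ↔ x ∈ E)) ∧
    sPerimeter s F U = p} with hS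
  have hinf : ∀ F, NullMeasurableSet F volume → (F \ U : Set _) =ᵐ[volume] (E \ U : Set _) →
      sInf S ≤ sPerimeter s F U := by
    intro F hF hFE
    obtain ⟨F', -, hF', hFF'⟩ := hF.exists_measurable_superset_ae_eq
    refine sInf_le ⟨F', hF', ?_, sPerimeter_congr (hF.congr hFF'.symm) hU.nullMeasurableSet hFF'⟩
    rw [diff_ae_eq_iff] at hFE
    filter_upwards [hFE, Filter.eventuallyEq_set.1 hFF'] with x h1 h2 h3
    rw [h2, h1 h3]
  have hSlt : sInf S < ∞ := by
    refine (hinf (E \ U) (hE.diff hU).nullMeasurableSet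
      (diff_ae_eq_iff.2 (Filter.Eventually.of_forall fun x hx => by simp [hx]))).trans_lt (lt_of_le_of_lt
      (sPerimeter_le_sKernel (hE.diff hU).nullMeasurableSet hU.nullMeasurableSet (by simp)) hUκ)
  -- Sets of almost optimal functions: closed by Fatou, midpoint convex by convexity, and each
  -- meeting the ball of radius `volume U ^ (1 / 2)` in an indicator. A common point has relaxed
  -- energy at most the infimum over sets.
  set K : ℕ → Set (Lp ℝ 2 (volume.restrict U)) := fun j =>
    {u | sVariation s U (extendByIndicator U E u) ≤ sInf S + ENNReal.ofReal (1 / ((j : ℝ) + 1))}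
    with hK
  have hmeas : ∀ u : Lp ℝ 2 (volume.restrict U), Measurable (extendByIndicator U E u) := fun u =>
    measurable_extendByIndicator hU hE (Lp.stronglyMeasurable u).measurable
  obtain ⟨u, hu⟩ : ∃ u, ∀ j, u ∈ K j := by
    refine exists_mem_of_antitone_midpoint_convex (R := (volume.restrict U).real univ ^ (1 / 2 : ℝ))
      ?_ ?_ ?_ ?_
    · intro i j hij u hu
      refine le_trans (show sVariation s U (extendByIndicator U E u) ≤ _ from hu) ?_
      gcongr
    · intro j
      refine IsSeqClosed.isClosed fun f u hf hfu => ?_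
      obtain ⟨φ, -, hφ⟩ := (tendstoInMeasure_of_tendsto_Lp hfu).exists_seq_tendsto_ae
      refine sVariation_le_of_tendsto (fun i => hmeas (f (φ i))) ?_ fun i => hf (φ i)
      rw [ae_restrict_iff' hU] at hφ
      filter_upwards [hφ] with x hx
      by_cases hxU : x ∈ U
      · simpa [extendByIndicator, hxU] using hx hxU
      · simp [extendByIndicator, hxU]
    · intro j u hu w hw
      have h1 := sVariation_midpoint (hmeas u) (hmeas w) hu hw
      refine le_trans (le_of_eq (sVariation_congr ?_)) h1
      have h2 := (Lp.coeFn_smul (1 / 2 : ℝ) (u + w)).trans ((Lp.coeFn_add u w).const_smul (1 / 2 : ℝ))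
      rw [Filter.EventuallyEq, ae_restrict_iff' hU] at h2
      filter_upwards [h2] with x hx
      by_cases hxU : x ∈ U
      · simpa [extendByIndicator, hxU] using hx hxU
      · simp [extendByIndicator, hxU]
        ring
    · intro j
      obtain ⟨p, ⟨F, hF, hFE, rfl⟩, hp⟩ := exists_lt_of_csInf_lt
        (show S.Nonempty from ⟨_, E, hE, by simp, rfl⟩)
        (ENNReal.lt_add_right hSlt.ne (b := ENNReal.ofReal (1 / ((j : ℝ) + 1)))
          (by simpa using Nat.cast_add_one_pos j))
      refine ⟨indicatorConstLp 2 hF (measure_ne_top _ _) 1, ?_, ?_⟩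
      · refine le_trans (le_of_eq ?_) hp.le
        rw [← sVariation_indicator hF hU]
        refine sVariation_congr ?_
        have h2 := indicatorConstLp_coeFn (μ := volume.restrict U) (p := 2) (hs := hF)
          (hμs := measure_ne_top _ _) (c := (1 : ℝ))
        rw [Filter.EventuallyEq, ae_restrict_iff' hU] at h2
        filter_upwards [h2, hFE] with x hx hx'
        by_cases hxU : x ∈ U
        · simpa [extendByIndicator, hxU, indicator] using hx hxU
        · simp [extendByIndicator, hxU, indicator, hx' hxU]
      · refine norm_indicatorConstLp_le.trans ?_
        have h2 : 1 / (2 : ℝ≥0∞).toReal = 1 / 2 := by simp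
        rw [norm_one, one_mul, h2]
        exact Real.rpow_le_rpow measureReal_nonneg (measureReal_mono (subset_univ F)) (by norm_num)
  obtain ⟨c, hc, hle⟩ := exists_superlevel_sPerimeter_le (s := s) hU (hmeas u)
  have hle2 : sPerimeter s {x | c < extendByIndicator U E u x} U ≤ sInf S := by
    refine hle.trans (ENNReal.le_of_forall_pos_le_add fun ε hε _ => ?_)
    obtain ⟨j, hj⟩ := exists_nat_one_div_lt (show (0 : ℝ) < ε from hε)
    refine le_trans (show sVariation s U (extendByIndicator U E u) ≤ _ from hu j) ?_
    gcongr
    rw [← ENNReal.ofReal_coe_nnreal]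
    exact ENNReal.ofReal_le_ofReal hj.le
  -- Outside `U` the function is the indicator of `E`, whose superlevel set is `E` exactly because
  -- `0 ≤ c < 1`.
  have hEF : ({x | c < extendByIndicator U E u x} \ U : Set _) =ᵐ[volume] (E \ U : Set _) := by
    rw [diff_ae_eq_iff]
    refine Filter.Eventually.of_forall fun x hx => ?_
    by_cases hxE : x ∈ E <;> simp [extendByIndicator, hx, hxE, hc.1.le, hc.2]
  refine ⟨_, ⟨(measurableSet_lt measurable_const (hmeas u)).nullMeasurableSet,
    hle2.trans_lt hSlt, fun G hG hGF => hle2.trans (hinf G hG (hGF.trans hEF))⟩, hEF⟩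

end Relaxed

/-! ### From local minimality to minimality up to the boundary -/

section Layer

variable {m : ℕ} {s : ℝ} {C K : ℝ≥0} {E U : Set (EuclideanSpace ℝ (Fin m))}

/-- The inner tubular neighbourhoods of the boundary of `U` have volume at most linear in their
width. -/
def BoundaryLayerBound (U : Set (EuclideanSpace ℝ (Fin m))) (C : ℝ≥0) : Prop :=
  ∀ h : ℝ, 0 < h → volume (U ∩ {x | infDist x Uᶜ ≤ h}) ≤ C * ENNReal.ofReal h

lemma infDist_compl_pos (hU : IsOpen U) (hne : Uᶜ.Nonempty) {x : EuclideanSpace ℝ (Fin m)}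
    (hx : x ∈ U) : 0 < infDist x Uᶜ :=
  (hU.isClosed_compl.notMem_iff_infDist_pos hne).1 (by simpa using hx)

lemma mem_of_infDist_compl_pos {x : EuclideanSpace ℝ (Fin m)} (hx : 0 < infDist x Uᶜ) : x ∈ U := by
  by_contra h
  rw [infDist_zero_of_mem (by exact h)] at hx
  exact lt_irrefl _ hx

/-- Dyadic layers: points at depth between `2 ^ (-(j + 1))` and `2 ^ (-j)` fill volume `O(2 ^
(-j))`, and each interacts with `Uᶜ` at strength `O(2 ^ (j s))`. The sum is geometric with ratio `2
^ (s - 1) < 1`. -/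
lemma sKernel_prod_compl_lt_top (hK : SKernelBound m s K) (hs1 : s < 1) (hU : IsOpen U)
    (hne : Uᶜ.Nonempty) (hfin : volume U < ∞) (hC : BoundaryLayerBound U C) :
    sKernel m s (U ×ˢ Uᶜ) < ∞ := by
  set S : ℕ → Set (EuclideanSpace ℝ (Fin m)) := fun j => U ∩ {x | infDist x Uᶜ ≤ (1 / 2 : ℝ) ^ j}
    with hS
  have hSm : ∀ j, MeasurableSet (S j) := fun j =>
    hU.measurableSet.inter (measurableSet_le (by fun_prop) measurable_const)
  have hfar : ∀ (A : Set (EuclideanSpace ℝ (Fin m))) (ρ : ℝ), ∀ x ∈ A, ∀ y ∈ Uᶜ,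
      ρ ≤ infDist x Uᶜ → ((x, y) : _ × _) ∈ {z : EuclideanSpace ℝ (Fin m) ×
        EuclideanSpace ℝ (Fin m) | z.1 ∈ A ∧ ρ ≤ ‖z.1 - z.2‖} := fun A ρ x hx y hy h =>
    ⟨hx, h.trans ((infDist_le_dist_of_mem hy).trans (dist_eq_norm x y).le)⟩
  have hcov : U ×ˢ Uᶜ ⊆ {z | z.1 ∈ U ∧ 1 ≤ ‖z.1 - z.2‖} ∪
      ⋃ j : ℕ, {z | z.1 ∈ S j ∧ (1 / 2 : ℝ) ^ (j + 1) ≤ ‖z.1 - z.2‖} := by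
    rintro ⟨x, y⟩ ⟨hx, hy⟩
    have hpos := infDist_compl_pos hU hne hx
    rcases le_or_gt 1 (infDist x Uᶜ) with h1 | h1
    · exact Or.inl (hfar U 1 x hx y hy h1)
    · obtain ⟨j, hj1, hj2⟩ := exists_nat_pow_near_of_lt_one hpos h1.le (y := (1 / 2 : ℝ))
        (by norm_num) (by norm_num)
      exact Or.inr (mem_iUnion.2 ⟨j, hfar (S j) _ x ⟨hx, hj2⟩ y hy hj1.le⟩)
  have hterm : ∀ j : ℕ, sKernel m s {z | z.1 ∈ S j ∧ (1 / 2 : ℝ) ^ (j + 1) ≤ ‖z.1 - z.2‖} ≤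
      K * C * ENNReal.ofReal ((2 : ℝ) ^ s * ((2 : ℝ) ^ (s - 1)) ^ j) := by
    intro j
    refine (hK.far (by positivity) (hSm j)).trans ?_
    refine (mul_le_mul_right (hC _ (by positivity)) _).trans (le_of_eq ?_)
    have e : ((1 / 2 : ℝ) ^ (j + 1)) ^ (-s) * (1 / 2 : ℝ) ^ j =
        (2 : ℝ) ^ s * ((2 : ℝ) ^ (s - 1)) ^ j := by
      rw [one_div, inv_pow, inv_pow, Real.inv_rpow (by positivity), Real.rpow_neg (by positivity),
        inv_inv, ← Real.rpow_natCast 2 (j + 1), ← Real.rpow_natCast 2 j,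
        ← Real.rpow_natCast _ j, ← Real.rpow_mul (by norm_num), ← Real.rpow_mul (by norm_num),
        ← Real.rpow_neg (by norm_num), ← Real.rpow_add (by norm_num), ← Real.rpow_add (by norm_num)]
      congr 1
      push_cast
      ring
    rw [← e, ENNReal.ofReal_mul (by positivity)]
    ring
  have hsum : Summable fun j : ℕ => (2 : ℝ) ^ s * ((2 : ℝ) ^ (s - 1)) ^ j :=
    (summable_geometric_of_lt_one (by positivity)
      (Real.rpow_lt_one_of_one_lt_of_neg one_lt_two (by linarith))).mul_left _
  refine (measure_mono hcov).trans_lt ((measure_union_le _ _).trans_lt (ENNReal.add_lt_top.2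
    ⟨(hK.far one_pos hU.measurableSet).trans_lt ?_, ?_⟩))
  · exact ENNReal.mul_lt_top (ENNReal.mul_lt_top (by simp) (by simp)) hfin
  · refine (measure_iUnion_le _).trans_lt ((ENNReal.tsum_le_tsum hterm).trans_lt ?_)
    rw [ENNReal.tsum_mul_left]
    exact ENNReal.mul_lt_top (ENNReal.mul_lt_top (by simp) (by simp)) hsum.tsum_ofReal_lt_top

/-- A pair counted for `F` has a point in `V`. If the other point is in `V`, or outside `U` where
`G` and `E` agree, the pair is already counted for `G`; otherwise it joins `V` to `U \ V`, in one of
two orders, whence the factor 2. -/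
lemma sPerimeter_glue_le {F G V : Set (EuclideanSpace ℝ (Fin m))}
    (hE : NullMeasurableSet E volume) (hG : NullMeasurableSet G volume)
    (hU : NullMeasurableSet U volume) (hV : NullMeasurableSet V volume) (hVU : V ⊆ U)
    (hGE : (G \ U : Set _) =ᵐ[volume] (E \ U : Set _)) (hF : F = (G ∩ V) ∪ (E \ V)) :
    sPerimeter s F V ≤ sPerimeter s G U + 2 * sKernel m s (V ×ˢ (U \ V)) := by
  have hFm : NullMeasurableSet F volume := hF ▸ (hG.inter hV).union (hE.diff hV)
  rw [sPerimeter_eq_sKernel hFm hV, sPerimeter_eq_sKernel hG hU, two_mul]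
  nth_rewrite 2 [sKernel_prod_comm hV (hU.diff hV)]
  refine le_trans (measure_mono_ae (t := ((G ×ˢ Gᶜ) \ (Uᶜ ×ˢ Uᶜ)) ∪
    (V ×ˢ (U \ V) ∪ (U \ V) ×ˢ V)) ?_) ((measure_union_le _ _).trans ?_)
  · rw [diff_ae_eq_iff] at hGE
    filter_upwards [ae_sKernel_fst hGE, ae_sKernel_snd hGE] with z h1 h2 hz
    have hz' : (z.1 ∈ F ∧ z.2 ∉ F) ∧ ¬(z.1 ∉ V ∧ z.2 ∉ V) := hz
    change z ∈ ((G ×ˢ Gᶜ) \ (Uᶜ ×ˢ Uᶜ)) ∪ (V ×ˢ (U \ V) ∪ (U \ V) ×ˢ V)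
    have hFV : ∀ x, x ∈ V → (x ∈ F ↔ x ∈ G) := fun x hx => by simp [hF, hx]
    have hFV' : ∀ x, x ∉ V → (x ∈ F ↔ x ∈ E) := fun x hx => by simp [hF, hx]
    obtain ⟨⟨hz1, hz2⟩, hz3⟩ := hz'
    by_cases hV1 : z.1 ∈ V
    · rw [hFV _ hV1] at hz1
      by_cases hV2 : z.2 ∈ V
      · rw [hFV _ hV2] at hz2
        exact Or.inl ⟨⟨hz1, hz2⟩, fun h => h.1 (hVU hV1)⟩
      · rw [hFV' _ hV2] at hz2
        by_cases hU2 : z.2 ∈ U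
        · exact Or.inr (Or.inl ⟨hV1, hU2, hV2⟩)
        · exact Or.inl ⟨⟨hz1, fun h => hz2 ((h2 hU2).1 h)⟩, fun h => h.1 (hVU hV1)⟩
    · have hV2 : z.2 ∈ V := by
        by_contra h
        exact hz3 ⟨hV1, h⟩
      rw [hFV' _ hV1] at hz1
      rw [hFV _ hV2] at hz2
      by_cases hU1 : z.1 ∈ U
      · exact Or.inr (Or.inr ⟨⟨hU1, hV1⟩, hV2⟩)
      · exact Or.inl ⟨⟨(h1 hU1).2 hz1, hz2⟩, fun h => h.2 (hVU hV2)⟩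
  · gcongr
    exact measure_union_le _ _

/-- Local minimality in `U` upgrades to minimality in `U` when `U` has finite fractional perimeter
and thin boundary layers. -/
lemma IsLocallySMinimal.isSMinimal (hK : SKernelBound m s K) (hs1 : s < 1) (hU : IsOpen U)
    (hUb : Bornology.IsBounded U) (hne : Uᶜ.Nonempty) (hC : BoundaryLayerBound U C)
    (hE : NullMeasurableSet E volume) (hloc : IsLocallySMinimal s E U) : IsSMinimal s E U := by
  have hUn := hU.measurableSet.nullMeasurableSet (μ := volume)
  set f : EuclideanSpace ℝ (Fin m) → ℝ := fun x => infDist x Uᶜ with hf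
  have hflip : LipschitzWith 1 f := lipschitz_infDist_pt _
  set V : ℝ → Set (EuclideanSpace ℝ (Fin m)) := fun c => {x | c < f x} with hV
  have hVo : ∀ c, IsOpen (V c) := fun c => isOpen_lt continuous_const hflip.continuous
  have hVn : ∀ c, NullMeasurableSet (V c) volume := fun c => (hVo c).measurableSet.nullMeasurableSet
  have hVU : ∀ c, 0 ≤ c → V c ⊆ U := fun c hc x hx =>
    mem_of_infDist_compl_pos (lt_of_le_of_lt hc hx)
  have hVc : ∀ c, 0 < c → CompactlyContained (V c) U := by
    intro c hc
    have h1 : closure (V c) ⊆ {x | c ≤ f x} :=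
      closure_minimal (fun x (hx : c < f x) => show c ≤ f x from hx.le) (isClosed_le continuous_const hflip.continuous)
    have h2 : closure (V c) ⊆ U := fun x hx => mem_of_infDist_compl_pos (hc.trans_le (h1 hx))
    exact ⟨isCompact_of_isClosed_isBounded isClosed_closure (hUb.subset h2), h2⟩
  have hmain : ∀ G, NullMeasurableSet G volume → (G \ U : Set _) =ᵐ[volume] (E \ U : Set _) →
      sPerimeter s E U ≤ sPerimeter s G U := by
    intro G hG hGE
    -- The cost of gluing at width `h = 1 / (j + 1)`: a factor `K * h ^ (-s)` from the choice of
    -- level times `C * h` from the layer volume. It tends to zero because `s < 1`.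
    set η : ℕ → ℝ≥0∞ := fun j => K * C * ENNReal.ofReal ((1 / ((j : ℝ) + 1)) ^ (1 - s)) with hη
    have hstep : ∀ j : ℕ, sPerimeter s E (V (1 / ((j : ℝ) + 1))) ≤ sPerimeter s G U + 2 * η j := by
      intro j
      have hh : 0 < 1 / ((j : ℝ) + 1) := Nat.one_div_pos_of_nat
      obtain ⟨c, hc, hle⟩ := hK.exists_level hflip hU.measurableSet hh
      have h1 : sKernel m s (V c ×ˢ (U \ V c)) ≤ η j := by
        have e : U \ V c = U ∩ {y | f y ≤ c} := by
          ext x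
          simp [hV]
        rw [e]
        refine hle.trans ((mul_le_mul_right (hC _ hh) _).trans (le_of_eq ?_))
        rw [hη]
        simp only
        rw [ofReal_rpow_one_sub hh]
        ring
      have hFm : NullMeasurableSet ((G ∩ V c) ∪ (E \ V c)) volume :=
        (hG.inter (hVn c)).union (hE.diff (hVn c))
      calc sPerimeter s E (V (1 / ((j : ℝ) + 1))) ≤ sPerimeter s E (V c) :=
            sPerimeter_mono hE (hVn _) (hVn _) fun x hx => hc.2.trans hx
        _ ≤ sPerimeter s ((G ∩ V c) ∪ (E \ V c)) (V c) := by
            refine (hloc _ (hVo c) (hVc c hc.1)).2.2 _ hFm ?_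
            rw [diff_ae_eq_iff]
            refine Filter.Eventually.of_forall fun x hx => ?_
            simp [hx]
        _ ≤ sPerimeter s G U + 2 * sKernel m s (V c ×ˢ (U \ V c)) :=
            sPerimeter_glue_le hE hG hUn (hVn c) (hVU c hc.1.le) hGE rfl
        _ ≤ _ := by gcongr
    have hlim1 : Filter.Tendsto (fun j : ℕ => sPerimeter s E (V (1 / ((j : ℝ) + 1)))) Filter.atTop
        (nhds (sPerimeter s E U)) := by
      have e : ∀ j : ℕ, sPerimeter s E (V (1 / ((j : ℝ) + 1))) = sKernel m s
          ((E ×ˢ Eᶜ) \ ((V (1 / ((j : ℝ) + 1)))ᶜ ×ˢ (V (1 / ((j : ℝ) + 1)))ᶜ)) :=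
        fun j => sPerimeter_eq_sKernel hE (hVn _)
      simp only [e]
      have hVmono : ∀ i j : ℕ, i ≤ j → V (1 / ((i : ℝ) + 1)) ⊆ V (1 / ((j : ℝ) + 1)) :=
        fun i j hij x (hx : _ < f x) =>
          show _ < f x from lt_of_le_of_lt (Nat.one_div_le_one_div hij) hx
      have hUV : ∀ x ∈ U, ∃ j : ℕ, x ∈ V (1 / ((j : ℝ) + 1)) := fun x hx =>
        exists_nat_one_div_lt (infDist_compl_pos hU hne hx)
      have hun : (E ×ˢ Eᶜ) \ (Uᶜ ×ˢ Uᶜ) = ⋃ j : ℕ,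
          ((E ×ˢ Eᶜ) \ ((V (1 / ((j : ℝ) + 1)))ᶜ ×ˢ (V (1 / ((j : ℝ) + 1)))ᶜ)) := by
        ext z
        simp only [mem_iUnion, mem_sdiff, mem_prod, mem_compl_iff]
        constructor
        · rintro ⟨h1, h2⟩
          by_cases h3 : z.1 ∈ U
          · obtain ⟨j, hj⟩ := hUV _ h3
            exact ⟨j, h1, fun h => h.1 hj⟩
          · obtain ⟨j, hj⟩ := hUV z.2 (by tauto)
            exact ⟨j, h1, fun h => h.2 hj⟩
        · rintro ⟨j, h1, h2⟩
          have h3 := hVU (1 / ((j : ℝ) + 1)) Nat.one_div_pos_of_nat.le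
          exact ⟨h1, fun h => h2 ⟨fun h' => h.1 (h3 h'), fun h' => h.2 (h3 h')⟩⟩
      rw [sPerimeter_eq_sKernel hE hUn, hun]
      refine tendsto_measure_iUnion_atTop fun i j hij => ?_
      refine sdiff_subset_sdiff_right (prod_mono ?_ ?_) <;>
        exact compl_subset_compl.2 (hVmono i j hij)
    have hlim2 : Filter.Tendsto (fun j : ℕ => sPerimeter s G U + 2 * η j) Filter.atTop
        (nhds (sPerimeter s G U)) := by
      have h1 : Filter.Tendsto (fun j : ℕ => (1 / ((j : ℝ) + 1)) ^ (1 - s)) Filter.atTop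
          (nhds 0) := by
        have := tendsto_one_div_add_atTop_nhds_zero_nat (𝕜 := ℝ)
        have h2 := this.rpow_const (p := 1 - s) (Or.inr (by linarith))
        rwa [Real.zero_rpow (by linarith)] at h2
      have h2 : Filter.Tendsto η Filter.atTop (nhds 0) := by
        have := ENNReal.Tendsto.const_mul (a := (K * C : ℝ≥0∞)) (ENNReal.tendsto_ofReal h1)
          (Or.inr (ENNReal.mul_ne_top (by simp) (by simp)))
        rwa [ENNReal.ofReal_zero, mul_zero] at this
      have h3 := ENNReal.Tendsto.const_mul (a := 2) h2 (Or.inr (by simp))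
      simpa using h3.const_add (sPerimeter s G U)
    exact le_of_tendsto_of_tendsto' hlim1 hlim2 hstep
  refine ⟨hE, ?_, hmain⟩
  refine (hmain (E \ U) (hE.diff hUn) ?_).trans_lt ((sPerimeter_le_sKernel (hE.diff hUn) hUn
    (by simp)).trans_lt (sKernel_prod_compl_lt_top hK hs1 hU hne hUb.measure_lt_top hC))
  exact diff_ae_eq_iff.2 (Filter.Eventually.of_forall fun x hx => by simp [hx])

end Layer

/-! ### Base and height coordinates, cylinders -/

section Coordinates

variable {n : ℕ} {Ω Ω' : Set (EuclideanSpace ℝ (Fin n))} {I J : Set ℝ}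

@[simp] lemma baseCoord_add (X Y : EuclideanSpace ℝ (Fin (n + 1))) :
    baseCoord (X + Y) = baseCoord X + baseCoord Y := rfl

@[simp] lemma baseCoord_sub (X Y : EuclideanSpace ℝ (Fin (n + 1))) :
    baseCoord (X - Y) = baseCoord X - baseCoord Y := rfl

@[simp] lemma baseCoord_smul (t : ℝ) (X : EuclideanSpace ℝ (Fin (n + 1))) :
    baseCoord (t • X) = t • baseCoord X := rfl

@[simp] lemma heightCoord_add (X Y : EuclideanSpace ℝ (Fin (n + 1))) :
    heightCoord (X + Y) = heightCoord X + heightCoord Y := rfl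

@[simp] lemma heightCoord_sub (X Y : EuclideanSpace ℝ (Fin (n + 1))) :
    heightCoord (X - Y) = heightCoord X - heightCoord Y := rfl

@[simp] lemma heightCoord_smul (t : ℝ) (X : EuclideanSpace ℝ (Fin (n + 1))) :
    heightCoord (t • X) = t * heightCoord X := rfl

/-- The point of `ℝ^{n+1}` with given base point and height. -/
def pointOf (x : EuclideanSpace ℝ (Fin n)) (t : ℝ) : EuclideanSpace ℝ (Fin (n + 1)) :=
  WithLp.toLp 2 (Fin.snoc (α := fun _ => ℝ) x t)

@[simp] lemma baseCoord_pointOf (x : EuclideanSpace ℝ (Fin n)) (t : ℝ) :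
    baseCoord (pointOf x t) = x := by
  ext i
  simp [baseCoord, pointOf]

@[simp] lemma heightCoord_pointOf (x : EuclideanSpace ℝ (Fin n)) (t : ℝ) :
    heightCoord (pointOf x t) = t := by
  simp [heightCoord, pointOf]

lemma norm_sq_eq_base_add_height (X : EuclideanSpace ℝ (Fin (n + 1))) :
    ‖X‖ ^ 2 = ‖baseCoord X‖ ^ 2 + heightCoord X ^ 2 := by
  rw [EuclideanSpace.real_norm_sq_eq, EuclideanSpace.real_norm_sq_eq, Fin.sum_univ_castSucc]
  rfl

lemma norm_baseCoord_le (X : EuclideanSpace ℝ (Fin (n + 1))) : ‖baseCoord X‖ ≤ ‖X‖ := by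
  refine le_of_sq_le_sq ?_ (norm_nonneg _)
  rw [norm_sq_eq_base_add_height X]
  linarith [sq_nonneg (heightCoord X)]

lemma abs_heightCoord_le (X : EuclideanSpace ℝ (Fin (n + 1))) : |heightCoord X| ≤ ‖X‖ := by
  refine abs_le_of_sq_le_sq ?_ (norm_nonneg _)
  rw [norm_sq_eq_base_add_height X]
  linarith [sq_nonneg ‖baseCoord X‖]

lemma norm_le_base_add_height (X : EuclideanSpace ℝ (Fin (n + 1))) :
    ‖X‖ ≤ ‖baseCoord X‖ + |heightCoord X| := by
  refine le_of_sq_le_sq ?_ (by positivity)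
  rw [norm_sq_eq_base_add_height X, ← sq_abs (heightCoord X)]
  nlinarith [norm_nonneg (baseCoord X), abs_nonneg (heightCoord X)]

@[fun_prop] lemma continuous_baseCoord : Continuous (baseCoord (n := n)) := by
  unfold baseCoord
  fun_prop

@[fun_prop] lemma continuous_heightCoord : Continuous (heightCoord (n := n)) := by
  unfold heightCoord
  fun_prop

lemma isOpen_cyl (hΩ : IsOpen Ω) (hI : IsOpen I) : IsOpen (cyl Ω I) :=
  (hΩ.preimage continuous_baseCoord).inter (hI.preimage continuous_heightCoord)

lemma measurableSet_cyl (hΩ : MeasurableSet Ω) (hI : MeasurableSet I) : MeasurableSet (cyl Ω I) :=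
  (continuous_baseCoord.measurable hΩ).inter (continuous_heightCoord.measurable hI)

lemma cyl_mono (h : Ω ⊆ Ω') (hI : I ⊆ J) : cyl Ω I ⊆ cyl Ω' J := fun _ hX => ⟨h hX.1, hI hX.2⟩

lemma isBounded_cyl (hΩ : Bornology.IsBounded Ω) (hI : Bornology.IsBounded I) :
    Bornology.IsBounded (cyl Ω I) := by
  obtain ⟨R, hR⟩ := isBounded_iff_forall_norm_le.1 hΩ
  obtain ⟨T, hT⟩ := isBounded_iff_forall_norm_le.1 hI
  exact isBounded_iff_forall_norm_le.2 ⟨R + T, fun X hX =>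
    (norm_le_base_add_height X).trans (add_le_add (hR _ hX.1) (hT _ hX.2))⟩

/-- Null sets of `ℝ^n` have null cylinders. -/
lemma ae_baseCoord {p : EuclideanSpace ℝ (Fin n) → Prop} (h : ∀ᵐ x, p x) :
    ∀ᵐ X : EuclideanSpace ℝ (Fin (n + 1)), p (baseCoord X) := by
  let L : EuclideanSpace ℝ (Fin (n + 1)) →ₗ[ℝ] EuclideanSpace ℝ (Fin n) :=
    { toFun := baseCoord, map_add' := fun _ _ => rfl, map_smul' := fun _ _ => rfl }
  have hL : Function.Surjective L := fun x => ⟨pointOf x 0, baseCoord_pointOf x 0⟩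
  obtain ⟨c, -, hc⟩ := L.exists_map_addHaar_eq_smul_addHaar volume volume hL
  have h1 : ∀ᵐ x ∂(Measure.map L volume), p x := by
    rw [hc]
    exact Measure.ae_smul_measure h c
  exact ae_of_ae_map (f := L) continuous_baseCoord.measurable.aemeasurable h1

lemma volume_heightCoord_eq (t : ℝ) :
    volume {X : EuclideanSpace ℝ (Fin (n + 1)) | heightCoord X = t} = 0 := by
  let L : EuclideanSpace ℝ (Fin (n + 1)) →ₗ[ℝ] ℝ :=
    { toFun := heightCoord, map_add' := fun _ _ => rfl, map_smul' := fun _ _ => rfl }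
  have hL : Function.Surjective L := fun x => ⟨pointOf 0 x, heightCoord_pointOf 0 x⟩
  obtain ⟨c, -, hc⟩ := L.exists_map_addHaar_eq_smul_addHaar volume volume hL
  have h1 : ∀ᵐ x ∂(Measure.map L volume), x ≠ t := by
    rw [hc]
    refine Measure.ae_smul_measure ?_ c
    simp [ae_iff]
  have h2 := ae_of_ae_map (f := L) continuous_heightCoord.measurable.aemeasurable h1
  rw [ae_iff] at h2
  simp only [not_not] at h2
  exact h2

lemma nullMeasurableSet_subgraph {v : EuclideanSpace ℝ (Fin n) → ℝ} (hv : AEMeasurable v volume) :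
    NullMeasurableSet (subgraph v) volume := by
  have h1 : MeasurableSet (subgraph (hv.mk v)) :=
    measurableSet_lt continuous_heightCoord.measurable
      (hv.measurable_mk.comp continuous_baseCoord.measurable)
  refine h1.nullMeasurableSet.congr (Filter.eventuallyEq_set.2 ?_)
  filter_upwards [ae_baseCoord hv.ae_eq_mk] with X hX
  change heightCoord X < hv.mk v (baseCoord X) ↔ heightCoord X < v (baseCoord X)
  rw [hX]

end Coordinates

/-! ### Volume of thin strips -/

section Strips

/-- Volume of a thin strip `{a ≤ g < a + τ}` of a function that increases at unit speed in a
fixed direction, by counting disjoint translates. -/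
lemma volume_strip_le {m : ℕ} {g : EuclideanSpace ℝ (Fin m) → ℝ} (hg : Measurable g)
    {w : EuclideanSpace ℝ (Fin m)} (hgw : ∀ x, ∀ t : ℝ, g (x + t • w) = g x + t)
    {D T : Set (EuclideanSpace ℝ (Fin m))} (hD : MeasurableSet D)
    (hDT : ∀ x ∈ D, ∀ t ∈ Icc (0 : ℝ) 1, x + t • w ∈ T) (a : ℝ) {τ : ℝ} (hτ : 0 < τ) :
    volume (D ∩ {x | a ≤ g x ∧ g x < a + τ}) ≤ ENNReal.ofReal τ * volume T := by
  set S := D ∩ {x | a ≤ g x ∧ g x < a + τ} with hS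
  have hSm : MeasurableSet S := hD.inter
    ((measurableSet_le measurable_const hg).inter (measurableSet_lt hg measurable_const))
  -- The translates by `0, τ, …, N τ ≤ 1` are disjoint and stay in `T`, while `(N + 1) τ ≥ 1`
  -- converts their number into the factor `τ`.
  set N := ⌊1 / τ⌋₊ with hN
  have hNle : (N : ℝ) * τ ≤ 1 := by
    rw [← le_div_iff₀ hτ]
    exact Nat.floor_le (by positivity)
  have hNlt : 1 ≤ ((N : ℝ) + 1) * τ := by
    rw [← div_le_iff₀ hτ]
    exact (Nat.lt_floor_add_one _).le
  set f : ℕ → Set (EuclideanSpace ℝ (Fin m)) := fun j => (· + (-((j : ℝ) * τ)) • w) ⁻¹' S with hf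
  have hfv : ∀ j, volume (f j) = volume S := fun j => measure_preimage_add_right _ _ _
  have hfm : ∀ j, MeasurableSet (f j) := fun j => (measurable_add_const _) hSm
  have hfg : ∀ j, ∀ x ∈ f j, a + j * τ ≤ g x ∧ g x < a + (j + 1) * τ := by
    intro j x hx
    have h1 := hx.2
    simp only [mem_ofPred_eq, hgw] at h1
    constructor <;> linarith [h1.1, h1.2]
  have hdisj : ∀ i j : ℕ, i < j → Disjoint (f i) (f j) := by
    intro i j hij
    refine disjoint_left.2 fun x hi hj => ?_
    have h1 := (hfg i x hi).2
    have h2 := (hfg j x hj).1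
    have h3 : (i : ℝ) + 1 ≤ j := by exact_mod_cast hij
    nlinarith
  have hsub : ⋃ j ∈ Finset.range (N + 1), f j ⊆ T := by
    refine iUnion₂_subset fun j hj x hx => ?_
    have h1 := hDT _ hx.1 ((j : ℝ) * τ) ⟨by positivity, ?_⟩
    · simpa using h1
    · have h3 : (j : ℝ) ≤ N := by exact_mod_cast Nat.lt_succ_iff.1 (Finset.mem_range.1 hj)
      nlinarith
  have hcard : ((N : ℝ≥0∞) + 1) * volume S ≤ volume T := by
    refine le_trans (le_of_eq ?_) (measure_mono hsub)
    rw [measure_biUnion_finset _ fun j _ => hfm j]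
    · simp [hfv]
    · intro i _ j _ hij
      rcases lt_or_gt_of_ne hij with h | h
      · exact hdisj i j h
      · exact (hdisj j i h).symm
  calc volume S ≤ ENNReal.ofReal (((N : ℝ) + 1) * τ) * volume S :=
        le_mul_of_one_le_left zero_le (by simpa using ENNReal.ofReal_le_ofReal hNlt)
    _ = ENNReal.ofReal τ * (((N : ℝ≥0∞) + 1) * volume S) := by
        rw [ENNReal.ofReal_mul (by positivity), ENNReal.ofReal_add (by positivity) one_pos.le,
          ENNReal.ofReal_natCast, ENNReal.ofReal_one]
        ring
    _ ≤ _ := by gcongr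

end Strips

/-! ### Boundary layers of cylinders over regular domains -/

section Domain

variable {n : ℕ} {Ω : Set (EuclideanSpace ℝ (Fin n))}

/-- Near a boundary point, a `C^{1,1}` domain is a sublevel set of a Lipschitz function increasing
at unit speed in a fixed direction. -/
lemma HasC11Boundary.exists_defining_function (hΩ : HasC11Boundary Ω)
    {x₀ : EuclideanSpace ℝ (Fin n)} (hx₀ : x₀ ∈ frontier Ω) :
    ∃ ρ : ℝ, 0 < ρ ∧ ∃ L : ℝ≥0, ∃ (ν : EuclideanSpace ℝ (Fin n)) (g : EuclideanSpace ℝ (Fin n) → ℝ),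
      ‖ν‖ = 1 ∧ Continuous g ∧ (∀ x, ∀ t : ℝ, g (x + t • ν) = g x + t) ∧
      ∀ x ∈ ball x₀ ρ, x ∈ Ω → ∀ z ∈ ball x₀ ρ, z ∉ Ω → -(L * dist x z) ≤ g x ∧ g x < 0 := by
  obtain ⟨r, hr, ν, hν, φ, hφd, ⟨K, hK⟩, hiff⟩ := hΩ x₀ hx₀
  have hφ : ContDiff ℝ 1 φ := contDiff_one_iff_fderiv.2 ⟨hφd, hK.continuous⟩
  -- The height above the graph in the direction `ν`: moving along `ν` does not change the
  -- horizontal coordinates, so `g` grows at unit speed. Being `C¹`, it is Lipschitz near `x₀`.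
  set g : EuclideanSpace ℝ (Fin n) → ℝ := fun x => inner ℝ x ν - φ (x - (inner ℝ x ν : ℝ) • ν)
    with hg
  have hgc : ContDiff ℝ 1 g := by
    have h1 : ContDiff ℝ 1 fun x : EuclideanSpace ℝ (Fin n) => (inner ℝ x ν : ℝ) :=
      contDiff_id.inner ℝ contDiff_const
    exact h1.sub (hφ.comp (contDiff_id.sub (h1.smul contDiff_const)))
  obtain ⟨L, t, ht, hL⟩ := (hgc.contDiffAt (x := x₀)).exists_lipschitzOnWith
  obtain ⟨ρ, hρ, hρt⟩ := Metric.mem_nhds_iff.1 ht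
  refine ⟨min ρ r, lt_min hρ hr, L, ν, g, hν, hgc.continuous, fun x t => ?_, ?_⟩
  · have h1 : (inner ℝ (x + t • ν) ν : ℝ) = inner ℝ x ν + t := by
      rw [inner_add_left, real_inner_smul_left, real_inner_self_eq_norm_sq, hν]
      ring
    have h2 : x + t • ν - (inner ℝ x ν + t : ℝ) • ν = x - (inner ℝ x ν : ℝ) • ν := by
      rw [add_smul]
      abel
    simp only [hg]
    rw [h1, h2]
    ring
  · intro x hx hxΩ z hz hzΩ
    have hxr := ball_subset_ball (min_le_right ρ r) hx
    have hzr := ball_subset_ball (min_le_right ρ r) hz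
    have h1 : g x < 0 := by
      have := (hiff x hxr).1 hxΩ
      simp only [hg]
      linarith
    have h2 : 0 ≤ g z := by
      have := mt (hiff z hzr).2 hzΩ
      simp only [hg]
      linarith
    have h3 := hL.dist_le_mul x (hρt (ball_subset_ball (min_le_left ρ r) hx)) z
      (hρt (ball_subset_ball (min_le_left ρ r) hz))
    rw [Real.dist_eq] at h3
    exact ⟨by linarith [neg_abs_le (g x - g z)], h1⟩

/-- The part of a cylinder over `Ω` within distance `h` of the lateral points over `S` has volume
`O(h)`. -/
lemma exists_lateral_bound (hΩo : IsOpen Ω) (hΩb : Bornology.IsBounded Ω) (hΩ : HasC11Boundary Ω)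
    (k : ℝ) :
    ∃ C : ℝ≥0, ∃ h₀ : ℝ, 0 < h₀ ∧ ∀ h : ℝ, 0 < h → h ≤ h₀ →
      volume {X | X ∈ cyl Ω (Ioo (-k) k) ∧ ∃ y ∈ frontier Ω, dist (baseCoord X) y ≤ h} ≤
        C * ENNReal.ofReal h := by
  have hc : IsCompact (frontier Ω) :=
    isCompact_of_isClosed_isBounded isClosed_frontier (hΩb.closure.subset frontier_subset_closure)
  -- By compactness of the boundary, and since the bound passes to subsets and unions, only small
  -- pieces around each boundary point matter.
  refine hc.induction_on (p := fun S => ∃ C : ℝ≥0, ∃ h₀ : ℝ, 0 < h₀ ∧ ∀ h : ℝ, 0 < h → h ≤ h₀ →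
      volume {X | X ∈ cyl Ω (Ioo (-k) k) ∧ ∃ y ∈ S, dist (baseCoord X) y ≤ h} ≤
        C * ENNReal.ofReal h) ⟨0, 1, one_pos, fun h _ _ => by simp⟩ ?_ ?_ ?_
  · rintro S T hST ⟨C, h₀, h₀pos, hT⟩
    refine ⟨C, h₀, h₀pos, fun h hh hh₀ => le_trans (measure_mono ?_) (hT h hh hh₀)⟩
    rintro X ⟨hX, y, hy, hd⟩
    exact ⟨hX, y, hST hy, hd⟩
  · rintro S T ⟨C, h₀, h₀pos, hS⟩ ⟨C', h₀', h₀pos', hT⟩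
    refine ⟨C + C', min h₀ h₀', lt_min h₀pos h₀pos', fun h hh hh₀ => ?_⟩
    rw [ENNReal.coe_add, add_mul]
    refine le_trans (measure_mono ?_) ((measure_union_le _ _).trans (add_le_add
      (hS h hh (hh₀.trans (min_le_left _ _))) (hT h hh (hh₀.trans (min_le_right _ _)))))
    rintro X ⟨hX, y, hy | hy, hd⟩
    · exact Or.inl ⟨hX, y, hy, hd⟩
    · exact Or.inr ⟨hX, y, hy, hd⟩
  · intro x₀ hx₀
    obtain ⟨ρ, hρ, L, ν, g, hν, hgc, hgt, hg⟩ := hΩ.exists_defining_function hx₀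
    set T := cyl (ball x₀ (ρ + 1)) (Ioo (-k) k) with hT
    have hTfin : volume T < ∞ := (isBounded_cyl isBounded_ball (isBounded_Ioo _ _)).measure_lt_top
    refine ⟨ball x₀ (ρ / 2) ∩ frontier Ω, inter_comm (ball x₀ (ρ / 2)) _ ▸
      inter_mem_nhdsWithin _ (ball_mem_nhds _ (half_pos hρ)), (L + 1) * (volume T).toNNReal, ρ / 2,
      half_pos hρ, fun h hh hh₀ => ?_⟩
    -- The slope `L + 1` instead of `L` keeps the width positive when `L = 0`; the radius `ρ + 1` in
    -- `T` leaves room for translates of length at most one.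
    have hstrip := volume_strip_le (g := fun X : EuclideanSpace ℝ (Fin (n + 1)) => g (baseCoord X))
      (by fun_prop) (w := pointOf ν 0) (fun X t => by simp [hgt])
      (D := cyl (ball x₀ ρ) (Ioo (-k) k)) (T := T)
      (measurableSet_cyl measurableSet_ball measurableSet_Ioo) ?_ (-((L + 1) * h))
      (τ := (L + 1) * h) (by positivity)
    · refine le_trans (measure_mono ?_) (hstrip.trans (le_of_eq ?_))
      · rintro X ⟨hX, y, ⟨hyb, hyf⟩, hd⟩
        have hxb : baseCoord X ∈ ball x₀ ρ := by
          rw [mem_ball] at hyb ⊢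
          linarith [dist_triangle (baseCoord X) y x₀]
        have hyΩ : y ∉ Ω := fun h => by
          rw [hΩo.frontier_eq] at hyf
          exact hyf.2 h
        obtain ⟨h1, h2⟩ := hg _ hxb hX.1 y (ball_subset_ball (by linarith) hyb) hyΩ
        refine ⟨⟨hxb, hX.2⟩, ?_, by simpa using h2⟩
        have h3 : (L : ℝ) * dist (baseCoord X) y ≤ L * h := by gcongr
        linarith
      · rw [ENNReal.ofReal_mul (by positivity), ENNReal.coe_mul, ENNReal.coe_toNNReal hTfin.ne,
          ENNReal.ofReal_add (by positivity) one_pos.le, ENNReal.ofReal_coe_nnreal,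
          ENNReal.ofReal_one, ENNReal.coe_add, ENNReal.coe_one]
        ring
    · rintro X ⟨hX1, hX2⟩ t ⟨ht0, ht1⟩
      refine ⟨?_, by simpa using hX2⟩
      simp only [baseCoord_add, baseCoord_smul, baseCoord_pointOf]
      rw [mem_ball] at hX1 ⊢
      have h1 : dist (baseCoord X + t • ν) (baseCoord X) ≤ 1 := by
        rw [dist_eq_norm, add_sub_cancel_left, norm_smul, hν, mul_one, Real.norm_of_nonneg ht0]
        exact ht1
      linarith [dist_triangle (baseCoord X + t • ν) (baseCoord X) x₀]

lemma cyl_compl_nonempty (hn : 1 ≤ n) (hΩb : Bornology.IsBounded Ω) (I : Set ℝ) :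
    (cyl Ω I)ᶜ.Nonempty := by
  have : Nonempty (Fin n) := ⟨⟨0, hn⟩⟩
  have h : Ω ≠ univ := fun h => NormedSpace.unbounded_univ ℝ (EuclideanSpace ℝ (Fin n)) (h ▸ hΩb)
  obtain ⟨x, hx⟩ := nonempty_compl.2 h
  exact ⟨pointOf x 0, fun hX => hx (by simpa using hX.1)⟩

/-- A nearest point of the complement either has its base outside `Ω`, which puts the point near the
lateral boundary, or has its height outside `(-k, k)`, which puts it near the top or the bottom. -/
lemma exists_boundaryLayerBound_cyl (hn : 1 ≤ n) (hΩo : IsOpen Ω) (hΩb : Bornology.IsBounded Ω)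
    (hΩ : HasC11Boundary Ω) (k : ℝ) :
    ∃ C : ℝ≥0, BoundaryLayerBound (cyl Ω (Ioo (-k) k)) C := by
  obtain ⟨C, h₀, h₀pos, hlat⟩ := exists_lateral_bound hΩo hΩb hΩ k
  set U := cyl Ω (Ioo (-k) k) with hU
  have hUo : IsOpen U := isOpen_cyl hΩo isOpen_Ioo
  have hUfin : volume U < ∞ := (isBounded_cyl hΩb (isBounded_Ioo _ _)).measure_lt_top
  set T := cyl Ω (Ioo (-(|k| + 1)) (|k| + 1)) with hT
  have hTfin : volume T < ∞ := (isBounded_cyl hΩb (isBounded_Ioo _ _)).measure_lt_top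
  have hvert : ∀ (σ : ℝ), σ * σ = 1 → ∀ h : ℝ, 0 < h →
      volume (U ∩ {X | -k ≤ σ * heightCoord X ∧ σ * heightCoord X < -k + 2 * h}) ≤
        ENNReal.ofReal (2 * h) * volume T := by
    intro σ hσ h hh
    have hσ' : |σ| = 1 := by
      rw [← sq_eq_sq₀ (abs_nonneg σ) zero_le_one, sq_abs, sq, hσ, one_pow]
    refine volume_strip_le (g := fun X => σ * heightCoord X)
      (by fun_prop) (w := pointOf 0 σ) (fun X t => ?_) hUo.measurableSet ?_ _ (by positivity)
    · simp only [heightCoord_add, heightCoord_smul, heightCoord_pointOf]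
      linear_combination t * hσ
    · rintro X ⟨hX1, hX2⟩ t ⟨ht0, ht1⟩
      refine ⟨by simpa using hX1, ?_⟩
      have h1 : |t * σ| ≤ 1 := by rw [abs_mul, hσ', mul_one, abs_of_nonneg ht0]; exact ht1
      have h2 := abs_le.1 h1
      have h3 := le_abs_self k
      simp only [heightCoord_add, heightCoord_smul, heightCoord_pointOf, mem_Ioo] at hX2 ⊢
      constructor <;> linarith [h2.1, h2.2, hX2.1, hX2.2]
  -- The 4 counts two strips of width `2 * h`, doubled because strips omit their upper end. The last
  -- summand handles `h > h₀`, where the full volume of `U` is an adequate bound.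
  refine ⟨C + 4 * (volume T).toNNReal + (volume U / ENNReal.ofReal h₀).toNNReal, fun h hh => ?_⟩
  rcases le_or_gt h h₀ with hle | hlt
  · have hsub : U ∩ {x | infDist x Uᶜ ≤ h} ⊆
        {X | X ∈ U ∧ ∃ y ∈ frontier Ω, dist (baseCoord X) y ≤ h} ∪
        (U ∩ {X | -k ≤ 1 * heightCoord X ∧ 1 * heightCoord X < -k + 2 * h} ∪
          U ∩ {X | -k ≤ -1 * heightCoord X ∧ -1 * heightCoord X < -k + 2 * h}) := by
      rintro X ⟨hX, hXd⟩
      obtain ⟨Z, hZ, hZd⟩ := hUo.isClosed_compl.exists_infDist_eq_dist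
        (cyl_compl_nonempty hn hΩb _) X
      have hXZ : ‖X - Z‖ ≤ h := by
        rw [← dist_eq_norm, ← hZd]
        exact hXd
      have hhX := abs_le.1 (((heightCoord_sub X Z) ▸ abs_heightCoord_le (X - Z)).trans hXZ)
      by_cases hZΩ : baseCoord Z ∈ Ω
      · have hZI : ¬(-k < heightCoord Z ∧ heightCoord Z < k) := fun h => hZ ⟨hZΩ, h⟩
        rcases not_and_or.1 hZI with h1 | h1
        · refine Or.inr (Or.inl ⟨hX, ?_⟩)
          have := hX.2.1
          constructor <;> linarith [hhX.2]
        · refine Or.inr (Or.inr ⟨hX, ?_⟩)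
          have := hX.2.2
          constructor <;> linarith [hhX.1]
      · refine Or.inl ⟨hX, ?_⟩
        obtain ⟨y, hy, hyd⟩ := exists_mem_frontier_infDist_compl_eq_dist hX.1
          (s := Ω) (fun h => hZΩ (h ▸ mem_univ _))
        refine ⟨y, hy, ?_⟩
        rw [← hyd]
        refine (infDist_le_dist_of_mem (show baseCoord Z ∈ Ωᶜ from hZΩ)).trans ?_
        rw [dist_eq_norm, ← baseCoord_sub]
        exact (norm_baseCoord_le _).trans hXZ
    calc volume (U ∩ {x | infDist x Uᶜ ≤ h}) ≤ C * ENNReal.ofReal h +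
          (ENNReal.ofReal (2 * h) * volume T + ENNReal.ofReal (2 * h) * volume T) :=
          (measure_mono hsub).trans ((measure_union_le _ _).trans (add_le_add (hlat h hh hle)
            ((measure_union_le _ _).trans (add_le_add (hvert 1 (by norm_num) h hh)
              (hvert (-1) (by norm_num) h hh)))))
      _ = (C + 4 * (volume T).toNNReal : ℝ≥0) * ENNReal.ofReal h := by
          rw [ENNReal.coe_add, ENNReal.coe_mul, ENNReal.coe_toNNReal hTfin.ne,
            ENNReal.ofReal_mul (by norm_num)]
          push_cast
          rw [ENNReal.ofReal_ofNat]
          ring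
      _ ≤ _ := mul_le_mul_left (ENNReal.coe_le_coe.2 le_self_add) _
  · calc volume (U ∩ {x | infDist x Uᶜ ≤ h}) ≤ volume U := measure_mono inter_subset_left
      _ = volume U / ENNReal.ofReal h₀ * ENNReal.ofReal h₀ :=
          (ENNReal.div_mul_cancel (by simpa using h₀pos) ENNReal.ofReal_ne_top).symm
      _ ≤ ((volume U / ENNReal.ofReal h₀).toNNReal : ℝ≥0∞) * ENNReal.ofReal h := by
          rw [ENNReal.coe_toNNReal (ENNReal.div_lt_top hUfin.ne (by simpa using h₀pos)).ne]
          gcongr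
      _ ≤ _ := by
          gcongr
          exact le_add_self

end Domain

/-! ### Point reflection of the kernel -/

section Reflection

variable {m : ℕ} {s : ℝ}

/-- The kernel is invariant under reflecting the second point through the first one. -/
lemma sKernel_preimage_reflect {S : Set (EuclideanSpace ℝ (Fin m) × EuclideanSpace ℝ (Fin m))}
    (hS : MeasurableSet S) :
    sKernel m s ((fun z => (z.1, z.1 + z.1 - z.2)) ⁻¹' S) = sKernel m s S := by
  have hm : Measurable fun z : EuclideanSpace ℝ (Fin m) × EuclideanSpace ℝ (Fin m) =>
    (z.1, z.1 + z.1 - z.2) := by fun_prop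
  rw [sKernel_apply hS, sKernel_apply (hm hS)]
  refine lintegral_congr fun x => ?_
  rw [← lintegral_indicator (measurable_prodMk_left hS),
    ← lintegral_indicator (measurable_prodMk_left (hm hS)),
    ← lintegral_sub_left_eq_self _ (x + x)]
  refine lintegral_congr fun y => ?_
  have h1 : x - (x + x - y) = -(x - y) := by abel
  have h2 : x + x - (x + x - y) = y := by abel
  by_cases h : (x, y) ∈ S <;> simp [indicator, h, h1, h2, norm_sub_rev y x]

end Reflection

/-! ### Balance between above and below -/

section Truncation

variable {n : ℕ} {s σ : ℝ} {K : ℝ≥0}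

lemma sKernel_height_eq (hσ : σ * σ = 1) :
    sKernel (n + 1) s {z | σ * heightCoord z.1 = σ * heightCoord z.2} = 0 := by
  refine sKernel_absolutelyContinuous ?_
  have hσ0 : σ ≠ 0 := fun h => by simp [h] at hσ
  rw [Measure.measure_prod_null (measurableSet_eq_fun (by fun_prop) (by fun_prop))]
  refine Filter.Eventually.of_forall fun x => ?_
  have h : Prod.mk x ⁻¹' {z : EuclideanSpace ℝ (Fin (n + 1)) × EuclideanSpace ℝ (Fin (n + 1)) |
      σ * heightCoord z.1 = σ * heightCoord z.2} = {y | heightCoord y = heightCoord x} := by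
    ext y
    simp [hσ0, eq_comm]
  simp only [h]
  exact volume_heightCoord_eq _

lemma measurableSet_height_lt (σ : ℝ) : MeasurableSet {z : EuclideanSpace ℝ (Fin (n + 1)) ×
    EuclideanSpace ℝ (Fin (n + 1)) | σ * heightCoord z.1 < σ * heightCoord z.2} :=
  measurableSet_lt (by fun_prop) (by fun_prop)

lemma measurableSet_height_gt (σ : ℝ) : MeasurableSet {z : EuclideanSpace ℝ (Fin (n + 1)) ×
    EuclideanSpace ℝ (Fin (n + 1)) | σ * heightCoord z.2 < σ * heightCoord z.1} :=
  measurableSet_lt (by fun_prop) (by fun_prop)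

/-- Points above and below (in direction `σ`) a set of finite volume, outside the set, interact
equally with it. -/
lemma sKernel_compl_above_eq_below (hK : SKernelBound (n + 1) s K) (σ : ℝ)
    {A : Set (EuclideanSpace ℝ (Fin (n + 1)))} (hA : MeasurableSet A) (hAfin : volume A < ∞) :
    sKernel (n + 1) s (A ×ˢ Aᶜ ∩ {z | σ * heightCoord z.1 < σ * heightCoord z.2}) =
      sKernel (n + 1) s (A ×ˢ Aᶜ ∩ {z | σ * heightCoord z.2 < σ * heightCoord z.1}) := by
  set Up : ℝ → Set (EuclideanSpace ℝ (Fin (n + 1)) × EuclideanSpace ℝ (Fin (n + 1))) := fun ε =>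
    {z | ε ≤ ‖z.1 - z.2‖ ∧ σ * heightCoord z.1 < σ * heightCoord z.2} with hUp
  set Dn : ℝ → Set (EuclideanSpace ℝ (Fin (n + 1)) × EuclideanSpace ℝ (Fin (n + 1))) := fun ε =>
    {z | ε ≤ ‖z.1 - z.2‖ ∧ σ * heightCoord z.2 < σ * heightCoord z.1} with hDn
  have hfar : ∀ ε : ℝ, MeasurableSet {z : EuclideanSpace ℝ (Fin (n + 1)) ×
      EuclideanSpace ℝ (Fin (n + 1)) | ε ≤ ‖z.1 - z.2‖} := fun ε =>
    measurableSet_le measurable_const (by fun_prop)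
  have hUpm : ∀ ε, MeasurableSet (Up ε) := fun ε =>
    (hfar ε).inter (measurableSet_height_lt σ)
  have hDnm : ∀ ε, MeasurableSet (Dn ε) := fun ε =>
    (hfar ε).inter (measurableSet_height_gt σ)
  have hAA : MeasurableSet (A ×ˢ A) := hA.prod hA
  have hAc : MeasurableSet (A ×ˢ Aᶜ) := hA.prod hA.compl
  have hfst : MeasurableSet (Prod.fst ⁻¹' A : Set (EuclideanSpace ℝ (Fin (n + 1)) ×
    EuclideanSpace ℝ (Fin (n + 1)))) := measurable_fst hA
  have hsplit : ∀ S : Set (EuclideanSpace ℝ (Fin (n + 1)) × EuclideanSpace ℝ (Fin (n + 1))),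
      MeasurableSet S → sKernel (n + 1) s (Prod.fst ⁻¹' A ∩ S) =
        sKernel (n + 1) s (A ×ˢ A ∩ S) + sKernel (n + 1) s (A ×ˢ Aᶜ ∩ S) := by
    intro S hS
    rw [← measure_union _ (hAc.inter hS)]
    · congr 1
      ext z
      simp only [mem_inter_iff, mem_preimage, mem_union, mem_prod, mem_compl_iff]
      tauto
    · refine disjoint_left.2 fun z hz hz' => hz'.1.2 hz.1.2
  -- Reflection exchanges above and below among pairs with first point in `A`, and swapping does so
  -- within `A ×ˢ A`. Subtracting the latter requires it to be finite, which is the purpose of the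
  -- cutoff at distance `ε`.
  have hε : ∀ ε, 0 < ε → sKernel (n + 1) s (A ×ˢ Aᶜ ∩ Up ε) =
      sKernel (n + 1) s (A ×ˢ Aᶜ ∩ Dn ε) := by
    intro ε hε
    have h1 : sKernel (n + 1) s (Prod.fst ⁻¹' A ∩ Up ε) =
        sKernel (n + 1) s (Prod.fst ⁻¹' A ∩ Dn ε) := by
      rw [← sKernel_preimage_reflect (hfst.inter (hDnm ε))]
      congr 1
      ext z
      have e : z.1 - (z.1 + z.1 - z.2) = -(z.1 - z.2) := by abel
      simp only [hUp, hDn, mem_inter_iff, mem_preimage, mem_ofPred_eq, e, norm_neg,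
        heightCoord_sub, heightCoord_add]
      refine and_congr_right fun _ => and_congr_right fun _ => ?_
      constructor <;> intro h <;> linarith
    have h2 : sKernel (n + 1) s (A ×ˢ A ∩ Up ε) = sKernel (n + 1) s (A ×ˢ A ∩ Dn ε) := by
      rw [← sKernel_swap (hAA.inter (hDnm ε)).nullMeasurableSet]
      congr 1
      ext z
      simp only [hUp, hDn, mem_inter_iff, mem_preimage, mem_ofPred_eq, mem_prod, Prod.fst_swap,
        Prod.snd_swap, norm_sub_rev z.2 z.1]
      tauto
    have h3 : sKernel (n + 1) s (A ×ˢ A ∩ Dn ε) ≠ ∞ := by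
      refine ((measure_mono ?_).trans_lt ((hK.far hε hA).trans_lt (ENNReal.mul_lt_top
        (ENNReal.mul_lt_top (by simp) (by simp)) hAfin))).ne
      exact fun z hz => ⟨hz.1.1, hz.2.1⟩
    rw [hsplit _ (hUpm ε), hsplit _ (hDnm ε), h2] at h1
    exact (ENNReal.add_right_inj h3).1 h1
  have hlim : ∀ (p : EuclideanSpace ℝ (Fin (n + 1)) × EuclideanSpace ℝ (Fin (n + 1)) → Prop),
      (∀ z, p z → z.1 ≠ z.2) → Filter.Tendsto (fun j : ℕ => sKernel (n + 1) s
        (A ×ˢ Aᶜ ∩ {z | 1 / ((j : ℝ) + 1) ≤ ‖z.1 - z.2‖ ∧ p z})) Filter.atTop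
        (nhds (sKernel (n + 1) s (A ×ˢ Aᶜ ∩ {z | p z}))) := by
    intro p hp
    have hun : A ×ˢ Aᶜ ∩ {z | p z} =
        ⋃ j : ℕ, A ×ˢ Aᶜ ∩ {z | 1 / ((j : ℝ) + 1) ≤ ‖z.1 - z.2‖ ∧ p z} := by
      ext z
      simp only [mem_inter_iff, mem_ofPred_eq, mem_iUnion]
      constructor
      · rintro ⟨h1, h2⟩
        obtain ⟨j, hj⟩ := exists_nat_one_div_lt (norm_pos_iff.2 (sub_ne_zero.2 (hp z h2)))
        exact ⟨j, h1, hj.le, h2⟩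
      · rintro ⟨j, h1, -, h2⟩
        exact ⟨h1, h2⟩
    rw [hun]
    refine tendsto_measure_iUnion_atTop fun i j hij => ?_
    rintro z ⟨h1, h2, h3⟩
    exact ⟨h1, (Nat.one_div_le_one_div hij).trans h2, h3⟩
  have hl1 := hlim (fun z => σ * heightCoord z.1 < σ * heightCoord z.2)
    fun z hz h => by simp [h] at hz
  have hl2 := hlim (fun z => σ * heightCoord z.2 < σ * heightCoord z.1)
    fun z hz h => by simp [h] at hz
  refine tendsto_nhds_unique (hl1.congr fun j => ?_) hl2
  exact hε _ Nat.one_div_pos_of_nat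

/-- If `A` interacts no more with `D` than with `B`, where `D` and `B` partition the complement of
`A`, then it interacts no more with the part of `D` below than with the part of `B` above. -/
lemma sKernel_below_le_above (hK : SKernelBound (n + 1) s K) (hσ : σ * σ = 1)
    {A B D : Set (EuclideanSpace ℝ (Fin (n + 1)))} (hA : MeasurableSet A) (hAfin : volume A < ∞)
    (hB : MeasurableSet B) (hD : MeasurableSet D) (hdisj : Disjoint D B) (hun : D ∪ B = Aᶜ)
    (hle : sKernel (n + 1) s (A ×ˢ D) ≤ sKernel (n + 1) s (A ×ˢ B))
    (hfin : sKernel (n + 1) s (A ×ˢ D) < ∞) :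
    sKernel (n + 1) s (A ×ˢ D ∩ {z | σ * heightCoord z.2 < σ * heightCoord z.1}) ≤
      sKernel (n + 1) s (A ×ˢ B ∩ {z | σ * heightCoord z.1 < σ * heightCoord z.2}) := by
  set Up : Set (EuclideanSpace ℝ (Fin (n + 1)) × EuclideanSpace ℝ (Fin (n + 1))) :=
    {z | σ * heightCoord z.1 < σ * heightCoord z.2} with hUp
  set Dn : Set (EuclideanSpace ℝ (Fin (n + 1)) × EuclideanSpace ℝ (Fin (n + 1))) :=
    {z | σ * heightCoord z.2 < σ * heightCoord z.1} with hDn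
  have hUpm : MeasurableSet Up := measurableSet_height_lt σ
  have hDnm : MeasurableSet Dn := measurableSet_height_gt σ
  have hsplit : ∀ S : Set (EuclideanSpace ℝ (Fin (n + 1)) × EuclideanSpace ℝ (Fin (n + 1))),
      MeasurableSet S → sKernel (n + 1) s (A ×ˢ Aᶜ ∩ S) =
        sKernel (n + 1) s (A ×ˢ D ∩ S) + sKernel (n + 1) s (A ×ˢ B ∩ S) := by
    intro S hS
    rw [← measure_union _ ((hA.prod hB).inter hS), ← hun, prod_union, union_inter_distrib_right]
    exact disjoint_left.2 fun z hz hz' => disjoint_left.1 hdisj hz.1.2 hz'.1.2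
  have heq := sKernel_compl_above_eq_below hK σ hA hAfin
  rw [← hUp, ← hDn, hsplit Up hUpm, hsplit Dn hDnm] at heq
  have hDsum : sKernel (n + 1) s (A ×ˢ D ∩ Up) + sKernel (n + 1) s (A ×ˢ D ∩ Dn) ≤
      sKernel (n + 1) s (A ×ˢ D) := by
    rw [← measure_union _ ((hA.prod hD).inter hDnm)]
    · exact measure_mono (union_subset inter_subset_left inter_subset_left)
    · exact disjoint_left.2 fun z hz hz' =>
        lt_asymm (show σ * heightCoord z.1 < σ * heightCoord z.2 from hz.2) hz'.2
  have hBsum : sKernel (n + 1) s (A ×ˢ B) ≤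
      sKernel (n + 1) s (A ×ˢ B ∩ Up) + sKernel (n + 1) s (A ×ˢ B ∩ Dn) := by
    refine le_trans (measure_mono (t := (A ×ˢ B ∩ Up ∪ A ×ˢ B ∩ Dn) ∪
      {z | σ * heightCoord z.1 = σ * heightCoord z.2}) ?_) ((measure_union_le _ _).trans ?_)
    · intro z hz
      rcases lt_trichotomy (σ * heightCoord z.1) (σ * heightCoord z.2) with h | h | h
      · exact Or.inl (Or.inl ⟨hz, h⟩)
      · exact Or.inr h
      · exact Or.inl (Or.inr ⟨hz, h⟩)
    · rw [sKernel_height_eq hσ, add_zero]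
      exact measure_union_le _ _
  have hle' := hDsum.trans (hle.trans hBsum)
  have hDu : sKernel (n + 1) s (A ×ˢ D ∩ Up) ≠ ∞ :=
    ((measure_mono inter_subset_left).trans_lt hfin).ne
  have hDd : sKernel (n + 1) s (A ×ˢ D ∩ Dn) ≠ ∞ :=
    ((measure_mono inter_subset_left).trans_lt hfin).ne
  by_cases hBu : sKernel (n + 1) s (A ×ˢ B ∩ Up) = ∞
  · rw [hBu]
    exact le_top
  have hBd : sKernel (n + 1) s (A ×ˢ B ∩ Dn) ≠ ∞ := by
    intro h
    rw [h, add_top] at heq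
    exact ENNReal.add_ne_top.2 ⟨hDu, hBu⟩ heq
  -- Balance reads `a + c = b + d` and the hypothesis gives `a + b ≤ c + d`; adding the two leaves
  -- `b ≤ c`.
  generalize sKernel (n + 1) s (A ×ˢ D ∩ Up) = a at *
  generalize sKernel (n + 1) s (A ×ˢ D ∩ Dn) = b at *
  generalize sKernel (n + 1) s (A ×ˢ B ∩ Up) = c at *
  generalize sKernel (n + 1) s (A ×ˢ B ∩ Dn) = d at *
  lift a to ℝ≥0 using hDu
  lift b to ℝ≥0 using hDd
  lift c to ℝ≥0 using hBu
  lift d to ℝ≥0 using hBd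
  norm_cast at heq hle' ⊢
  have h1 : (a : ℝ) + c = b + d := by exact_mod_cast heq
  have h2 : (a : ℝ) + b ≤ c + d := by exact_mod_cast hle'
  exact_mod_cast (show (b : ℝ) ≤ c by linarith)

end Truncation

/-! ### The truncation inequality -/

section Height

variable {n : ℕ} {s σ : ℝ} {K : ℝ≥0} {Ω : Set (EuclideanSpace ℝ (Fin n))}

lemma abs_sign_mul_heightCoord (hσ : σ * σ = 1) (X : EuclideanSpace ℝ (Fin (n + 1))) :
    |σ * heightCoord X| = |heightCoord X| := by
  have h : |σ| = 1 := by rw [← sq_eq_sq₀ (abs_nonneg σ) zero_le_one, sq_abs, sq, hσ, one_pow]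
  rw [abs_mul, h, one_mul]

lemma exists_far_constant (hs0 : 0 < s) (K : ℝ≥0) {c : ℝ≥0} (hc : 0 < c) :
    ∃ R : ℝ, 0 < R ∧ (K : ℝ≥0∞) * ENNReal.ofReal (R ^ (-s)) ≤ c := by
  have h1 : Filter.Tendsto (fun R : ℝ => (K : ℝ≥0∞) * ENNReal.ofReal (R ^ (-s))) Filter.atTop
      (nhds 0) := by
    have := ENNReal.Tendsto.const_mul (a := (K : ℝ≥0∞))
      (ENNReal.tendsto_ofReal (tendsto_rpow_neg_atTop hs0)) (Or.inr (by simp))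
    rwa [ENNReal.ofReal_zero, mul_zero] at this
  have h2 := (h1.eventually_lt_const (show (0 : ℝ≥0∞) < c by exact_mod_cast hc)).and
    (Filter.eventually_gt_atTop 0)
  obtain ⟨R, h3, h4⟩ := h2.exists
  exact ⟨R, h4, h3.le⟩

lemma mul_volume_le_sKernel_ball {m : ℕ} {A : Set (EuclideanSpace ℝ (Fin m))} (hA : MeasurableSet A)
    (hs0 : 0 < s) {w : EuclideanSpace ℝ (Fin m)} (hw : 1 ≤ ‖w‖) :
    ENNReal.ofReal (1 / (‖w‖ + 1) ^ ((m : ℝ) + s)) *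
      volume (ball (0 : EuclideanSpace ℝ (Fin m)) 1) * volume A ≤
      sKernel m s {z | z.1 ∈ A ∧ z.2 ∈ ball (z.1 + w) 1} := by
  have hS : MeasurableSet {z : EuclideanSpace ℝ (Fin m) × EuclideanSpace ℝ (Fin m) |
      z.1 ∈ A ∧ z.2 ∈ ball (z.1 + w) 1} :=
    (measurable_fst hA).inter (measurableSet_lt (f := fun z : EuclideanSpace ℝ (Fin m) ×
      EuclideanSpace ℝ (Fin m) => dist z.2 (z.1 + w)) (by fun_prop) measurable_const)
  rw [sKernel_apply hS, ← setLIntegral_const, ← lintegral_indicator hA]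
  refine lintegral_mono fun x => indicator_apply_le' (fun hx => ?_) fun _ => zero_le
  have hslice : Prod.mk x ⁻¹' {z : EuclideanSpace ℝ (Fin m) × EuclideanSpace ℝ (Fin m) |
      z.1 ∈ A ∧ z.2 ∈ ball (z.1 + w) 1} = ball (x + w) 1 := by
    ext y
    simp [hx]
  rw [hslice, ← Measure.addHaar_ball_center volume (x + w) 1, ← setLIntegral_const]
  refine setLIntegral_mono' measurableSet_ball fun y hy => ENNReal.ofReal_le_ofReal ?_
  rw [mem_ball, dist_eq_norm] at hy
  have h1 : ‖w‖ ≤ ‖x - y‖ + ‖y - (x + w)‖ := by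
    have h := norm_sub_le (y - x) (y - (x + w))
    rw [norm_sub_rev y x] at h
    have e : y - x - (y - (x + w)) = w := by abel
    rwa [e] at h
  have h2 : ‖x - y‖ ≤ ‖y - (x + w)‖ + ‖w‖ := by
    have h := norm_add_le (y - (x + w)) w
    have e : y - (x + w) + w = y - x := by abel
    rwa [e, norm_sub_rev] at h
  -- Positivity matters: the kernel takes the value `1 / 0 = 0` on the diagonal, and `1 ≤ ‖w‖` keeps
  -- the ball away from it.
  have h3 : 0 < ‖x - y‖ := by linarith
  have h4 : 0 < (m : ℝ) + s := by positivity
  gcongr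
  linarith

/-- Truncating a minimizer at a large height `M`: the removed volume is controlled by the
interaction with the part of the set above the domain of minimality. -/
lemma exists_truncation_constants (hn : 1 ≤ n) (hs0 : 0 < s) (hK : SKernelBound (n + 1) s K)
    (hΩo : IsOpen Ω) (hΩb : Bornology.IsBounded Ω) (T : ℝ → ℝ) :
    ∃ c : ℝ≥0, 0 < c ∧ ∃ M₀ : ℝ, 0 < M₀ ∧ ∀ σ : ℝ, σ * σ = 1 →
      ∀ E : Set (EuclideanSpace ℝ (Fin (n + 1))), MeasurableSet E →
      (∀ r : ℝ, 0 < r → ∀ᵐ X : EuclideanSpace ℝ (Fin (n + 1)), baseCoord X ∉ Ω →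
        ‖baseCoord X‖ ≤ r → T r < σ * heightCoord X → X ∉ E) →
      ∀ M : ℝ, M₀ ≤ M → ∀ k : ℝ, IsSMinimal s E (cyl Ω (Ioo (-k) k)) →
        c * volume {X | X ∈ E ∧ baseCoord X ∈ Ω ∧ M < σ * heightCoord X ∧ σ * heightCoord X < k} ≤
          sKernel (n + 1) s
            ({X | X ∈ E ∧ baseCoord X ∈ Ω ∧ M < σ * heightCoord X ∧ σ * heightCoord X < k} ×ˢ
              {X | X ∈ E ∧ baseCoord X ∈ Ω ∧ k ≤ σ * heightCoord X}) := by
  obtain ⟨ρ, hρ, hΩρ⟩ : ∃ ρ : ℝ, 0 < ρ ∧ ∀ x ∈ Ω, ‖x‖ ≤ ρ := by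
    obtain ⟨ρ, hρ⟩ := isBounded_iff_forall_norm_le.1 hΩb
    exact ⟨max ρ 1, by positivity, fun x hx => (hρ x hx).trans (le_max_left _ _)⟩
  obtain ⟨e, he⟩ : ∃ e : EuclideanSpace ℝ (Fin n), ‖e‖ = 1 :=
    ⟨EuclideanSpace.single ⟨0, hn⟩ 1, by simp⟩
  -- `d` bounds `‖w‖ + 1` for the shift `w` used below, so each point interacts with the unit ball
  -- around its shift at strength at least `c₀`. Half of `c₀` will be spent on distant points.
  set d : ℝ := (2 * ρ + 2) + 2 + 1 with hd
  set c₀ : ℝ≥0∞ := ENNReal.ofReal (1 / d ^ (((n + 1 : ℕ) : ℝ) + s)) *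
    volume (ball (0 : EuclideanSpace ℝ (Fin (n + 1))) 1) with hc₀
  have hc₀pos : 0 < c₀ := by
    refine ENNReal.mul_pos ?_ (measure_ball_pos _ _ one_pos).ne'
    have : 0 < 1 / d ^ (((n + 1 : ℕ) : ℝ) + s) := by positivity
    simpa using this
  have hc₀top : c₀ ≠ ∞ := ENNReal.mul_ne_top ENNReal.ofReal_ne_top measure_ball_lt_top.ne
  obtain ⟨c, hc, hcc⟩ : ∃ c : ℝ≥0, 0 < c ∧ (c : ℝ≥0∞) + c = c₀ := by
    have h1 : c₀ / 2 ≠ ∞ := (ENNReal.div_lt_top hc₀top (by simp)).ne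
    refine ⟨(c₀ / 2).toNNReal, ENNReal.toNNReal_pos (ENNReal.half_pos hc₀pos.ne').ne' h1, ?_⟩
    rw [ENNReal.coe_toNNReal h1, ENNReal.add_halves]
  obtain ⟨R, hR, hRc⟩ := exists_far_constant hs0 K hc
  -- The thresholds place heights down to `M - 3` above the datum over radius `3 * ρ + 3`, heights
  -- beyond `M` above the datum over radius `R + ρ`, and make `M` positive.
  refine ⟨c, hc, max (max (T (3 * ρ + 3) + 3) (T (R + ρ))) 1, by positivity, ?_⟩
  intro σ hσ E hE hext M hM k hmin
  have hM1 : T (3 * ρ + 3) + 3 ≤ M := ((le_max_left _ _).trans (le_max_left _ _)).trans hM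
  have hM2 : T (R + ρ) ≤ M := ((le_max_right _ _).trans (le_max_left _ _)).trans hM
  have hM0 : 1 ≤ M := (le_max_right _ _).trans hM
  have hσ' : |σ| = 1 := by
    rw [← sq_eq_sq₀ (abs_nonneg σ) zero_le_one, sq_abs, sq, hσ, one_pow]
  have hσabs := abs_sign_mul_heightCoord (n := n) hσ
  set U := cyl Ω (Ioo (-k) k) with hU
  have hUm : MeasurableSet U := measurableSet_cyl hΩo.measurableSet measurableSet_Ioo
  have hUfin : volume U < ∞ := (isBounded_cyl hΩb (isBounded_Ioo _ _)).measure_lt_top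
  have hbm : MeasurableSet {X : EuclideanSpace ℝ (Fin (n + 1)) | baseCoord X ∈ Ω} :=
    continuous_baseCoord.measurable hΩo.measurableSet
  have hhm : Measurable fun X : EuclideanSpace ℝ (Fin (n + 1)) => σ * heightCoord X := by fun_prop
  set A := {X | X ∈ E ∧ baseCoord X ∈ Ω ∧ M < σ * heightCoord X ∧ σ * heightCoord X < k} with hA
  have hAm : MeasurableSet A := hE.inter (hbm.inter ((measurableSet_lt measurable_const hhm).inter
    (measurableSet_lt hhm measurable_const)))
  have hAE : A ⊆ E := fun X hX => hX.1
  have hAU : A ⊆ U := fun X hX => by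
    refine ⟨hX.2.1, ?_⟩
    rw [mem_Ioo, ← abs_lt, ← hσabs X, abs_of_pos (by linarith [hX.2.2.1])]
    exact hX.2.2.2
  have hAfin : volume A < ∞ := (measure_mono hAU).trans_lt hUfin
  obtain ⟨hle, hfin⟩ := hmin.sKernel_prod_compl_le hUm.nullMeasurableSet hAm.nullMeasurableSet
    hAE hAU
  have hkey := sKernel_below_le_above hK hσ hAm hAfin (hE.diff hAm) hE.compl
    (disjoint_left.2 fun x hx hx' => hx hx'.1) (by
      ext x
      have := @hAE x
      simp only [mem_union, mem_compl_iff, mem_sdiff]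
      tauto) hle hfin
  -- The horizontal shift `2 * ρ + 2` carries a whole unit ball out of the cylinder, and the
  -- vertical shift by 2 against `σ` leaves it strictly below the original point yet above the
  -- datum, hence inside `Eᶜ`.
  set w : EuclideanSpace ℝ (Fin (n + 1)) := pointOf ((2 * ρ + 2) • e) (-2 * σ) with hw
  have hwn : ‖w‖ ≤ (2 * ρ + 2) + 2 := by
    refine (norm_le_base_add_height w).trans (le_of_eq ?_)
    rw [hw, baseCoord_pointOf, heightCoord_pointOf, norm_smul, he, mul_one, abs_mul, hσ',
      Real.norm_of_nonneg (by positivity)]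
    norm_num
  have hwn' : 1 ≤ ‖w‖ := by
    refine le_trans ?_ (abs_heightCoord_le w)
    rw [hw, heightCoord_pointOf, abs_mul, hσ']
    norm_num
  have hlow : c₀ * volume A ≤ sKernel (n + 1) s
      (A ×ˢ Eᶜ ∩ {z | σ * heightCoord z.2 < σ * heightCoord z.1}) := by
    refine le_trans ?_ ((mul_volume_le_sKernel_ball hAm hs0 hwn').trans (measure_mono_ae ?_))
    · gcongr
      rw [hc₀]
      gcongr
      linarith
    · filter_upwards [ae_sKernel_snd (hext (3 * ρ + 3) (by positivity))] with z hz hzm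
      obtain ⟨hzA, hzb⟩ : z.1 ∈ A ∧ z.2 ∈ ball (z.1 + w) 1 := hzm
      obtain ⟨y, hy, hzy⟩ : ∃ y, ‖y‖ < 1 ∧ z.2 = z.1 + w + y :=
        ⟨z.2 - (z.1 + w), by rwa [mem_ball, dist_eq_norm] at hzb, by abel⟩
      have hb : baseCoord z.2 = (2 * ρ + 2) • e + (baseCoord z.1 + baseCoord y) := by
        rw [hzy, hw]
        simp only [baseCoord_add, baseCoord_pointOf]
        abel
      have hh : σ * heightCoord z.2 = σ * heightCoord z.1 - 2 + σ * heightCoord y := by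
        rw [hzy, hw]
        simp only [heightCoord_add, heightCoord_pointOf]
        linear_combination -2 * hσ
      have hyh := abs_lt.1 ((hσabs y ▸ abs_heightCoord_le y).trans_lt hy)
      have hn1 : ‖baseCoord z.1 + baseCoord y‖ ≤ ρ + 1 := (norm_add_le _ _).trans
        (add_le_add (hΩρ _ hzA.2.1) ((norm_baseCoord_le y).trans hy.le))
      have hn2 : ‖(2 * ρ + 2) • e‖ = 2 * ρ + 2 := by
        rw [norm_smul, he, mul_one, Real.norm_of_nonneg (by positivity)]
      have hn3 : ρ + 1 ≤ ‖baseCoord z.2‖ := by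
        have := norm_sub_le_norm_add ((2 * ρ + 2) • e) (baseCoord z.1 + baseCoord y)
        rw [hb]
        linarith
      have hn4 : ‖baseCoord z.2‖ ≤ 3 * ρ + 3 := by
        have := norm_add_le ((2 * ρ + 2) • e) (baseCoord z.1 + baseCoord y)
        rw [hb]
        linarith
      have hzh := hzA.2.2.1
      refine ⟨⟨hzA, hz (fun h => ?_) hn4 (by linarith [hyh.1])⟩, ?_⟩
      · linarith [hΩρ _ h]
      · change σ * heightCoord z.2 < σ * heightCoord z.1
        linarith [hyh.2]
  -- Beyond height `M` and off `Ω`, `E` lives only over radii larger than `R + ρ`, thus at distance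
  -- at least `R` from `A`. By the choice of `R` this part costs at most `c * volume A`.
  have hup : sKernel (n + 1) s
      (A ×ˢ (E \ A) ∩ {z | σ * heightCoord z.1 < σ * heightCoord z.2}) ≤
      sKernel (n + 1) s (A ×ˢ {X | X ∈ E ∧ baseCoord X ∈ Ω ∧ k ≤ σ * heightCoord X}) +
        c * volume A := by
    refine le_trans (measure_mono_ae (t := A ×ˢ {X | X ∈ E ∧ baseCoord X ∈ Ω ∧
      k ≤ σ * heightCoord X} ∪ {z | z.1 ∈ A ∧ R ≤ ‖z.1 - z.2‖}) ?_) ((measure_union_le _ _).trans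
        (add_le_add le_rfl ((hK.far hR hAm).trans (by gcongr))))
    filter_upwards [ae_sKernel_snd (hext (R + ρ) (by positivity))] with z hz hzm
    obtain ⟨⟨hzA, hzE, hzA'⟩, hzh⟩ : (z.1 ∈ A ∧ z.2 ∈ E ∧ z.2 ∉ A) ∧
      σ * heightCoord z.1 < σ * heightCoord z.2 := hzm
    have hMz := hzA.2.2.1.trans hzh
    by_cases hzΩ : baseCoord z.2 ∈ Ω
    · exact Or.inl ⟨hzA, hzE, hzΩ, not_lt.1 fun h => hzA' ⟨hzE, hzΩ, hMz, h⟩⟩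
    · refine Or.inr ⟨hzA, ?_⟩
      have h1 : R + ρ < ‖baseCoord z.2‖ :=
        not_le.1 fun h => hz hzΩ h (lt_of_le_of_lt hM2 hMz) hzE
      have h2 := norm_baseCoord_le (z.1 - z.2)
      rw [baseCoord_sub, norm_sub_rev] at h2
      have h3 := norm_sub_norm_le (baseCoord z.2) (baseCoord z.1)
      linarith [hΩρ _ hzA.2.1]
  have hfinal := hlow.trans (hkey.trans hup)
  rw [← hcc, add_mul] at hfinal
  exact (ENNReal.add_le_add_iff_right (ENNReal.mul_lt_top (by simp) hAfin).ne).1 hfinal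

end Height

/-! ### Vanishing above a fixed height -/

section Height

variable {n : ℕ} {s σ : ℝ} {K : ℝ≥0} {Ω : Set (EuclideanSpace ℝ (Fin n))}

/-- Translating the slab to height zero gives a bound independent of `j`. -/
lemma volume_slab_le (hσ : σ * σ = 1) (j H : ℝ) :
    volume {X : EuclideanSpace ℝ (Fin (n + 1)) |
      baseCoord X ∈ Ω ∧ j ≤ σ * heightCoord X ∧ σ * heightCoord X ≤ j + H} ≤
      volume (cyl Ω (Icc (-H) H)) := by
  rw [← measure_preimage_add_right volume (pointOf (0 : EuclideanSpace ℝ (Fin n)) (-(j * σ)))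
    (cyl Ω (Icc (-H) H))]
  refine measure_mono fun X hX => ?_
  obtain ⟨h1, h2, h3⟩ := hX
  refine ⟨by simpa using h1, ?_⟩
  rw [mem_Icc, ← abs_le, ← abs_sign_mul_heightCoord hσ, heightCoord_add, heightCoord_pointOf,
    abs_le]
  have e : σ * (heightCoord X + -(j * σ)) = σ * heightCoord X - j := by
    linear_combination -j * hσ
  rw [e]
  constructor <;> linarith

/-- A set satisfying the truncation inequality at all heights vanishes above `M`. -/
lemma volume_above_eq_zero (hs0 : 0 < s) (hK : SKernelBound (n + 1) s K) (hΩo : IsOpen Ω)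
    (hΩb : Bornology.IsBounded Ω) (hσ : σ * σ = 1) {E : Set (EuclideanSpace ℝ (Fin (n + 1)))}
    (hE : MeasurableSet E) {c : ℝ≥0} (hc : 0 < c) {M : ℝ} (hM : 0 < M)
    (htr : ∀ k : ℝ, 0 < k →
      c * volume {X | X ∈ E ∧ baseCoord X ∈ Ω ∧ M < σ * heightCoord X ∧ σ * heightCoord X < k} ≤
        sKernel (n + 1) s
          ({X | X ∈ E ∧ baseCoord X ∈ Ω ∧ M < σ * heightCoord X ∧ σ * heightCoord X < k} ×ˢ
            {X | X ∈ E ∧ baseCoord X ∈ Ω ∧ k ≤ σ * heightCoord X})) :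
    volume {X | X ∈ E ∧ baseCoord X ∈ Ω ∧ M < σ * heightCoord X} = 0 := by
  obtain ⟨H, hH, hHc⟩ := exists_far_constant hs0 K (half_pos hc)
  have hbm : MeasurableSet {X : EuclideanSpace ℝ (Fin (n + 1)) | baseCoord X ∈ Ω} :=
    continuous_baseCoord.measurable hΩo.measurableSet
  have hhm : Measurable fun X : EuclideanSpace ℝ (Fin (n + 1)) => σ * heightCoord X := by fun_prop
  set A : ℝ → Set (EuclideanSpace ℝ (Fin (n + 1))) := fun k =>
    {X | X ∈ E ∧ baseCoord X ∈ Ω ∧ M < σ * heightCoord X ∧ σ * heightCoord X < k} with hA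
  set A' : Set (EuclideanSpace ℝ (Fin (n + 1))) :=
    {X | X ∈ E ∧ baseCoord X ∈ Ω ∧ M < σ * heightCoord X} with hA'
  set S : ℝ → Set (EuclideanSpace ℝ (Fin (n + 1))) := fun j =>
    {X | X ∈ E ∧ baseCoord X ∈ Ω ∧ j ≤ σ * heightCoord X ∧ σ * heightCoord X ≤ j + (1 + H)} with hS
  have hAm : ∀ k, MeasurableSet (A k) := fun k => hE.inter (hbm.inter
    ((measurableSet_lt measurable_const hhm).inter (measurableSet_lt hhm measurable_const)))
  have hA'm : MeasurableSet A' := hE.inter (hbm.inter (measurableSet_lt measurable_const hhm))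
  have hSm : ∀ j, MeasurableSet (S j) := fun j => hE.inter (hbm.inter
    ((measurableSet_le measurable_const hhm).inter (measurableSet_le hhm measurable_const)))
  have hAfin : ∀ k, volume (A k) < ∞ := by
    refine fun k => (measure_mono ?_).trans_lt
      (isBounded_cyl hΩb (isBounded_Ioo (-k) k)).measure_lt_top
    intro X hX
    refine ⟨hX.2.1, ?_⟩
    rw [mem_Ioo, ← abs_lt, ← abs_sign_mul_heightCoord hσ X, abs_of_pos (hM.trans hX.2.2.1)]
    exact hX.2.2.2
  -- A cut height `k = j + 1 - t` in `(j, j + 1)` is chosen by averaging. Points of `E` above it lie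
  -- in the slab `S j` or at distance at least `H` from `A k`; the distant ones cost half of the
  -- left side and are absorbed.
  have hstep : ∀ j : ℝ, 0 < j → ((c / 2 : ℝ≥0) : ℝ≥0∞) * volume (A j) ≤ K * volume (S j) := by
    intro j hj
    have hlip : LipschitzWith 1 fun X : EuclideanSpace ℝ (Fin (n + 1)) =>
        j + 1 - σ * heightCoord X := by
      refine LipschitzWith.of_dist_le_mul fun X Y => ?_
      rw [NNReal.coe_one, one_mul, Real.dist_eq, dist_eq_norm]
      have e : j + 1 - σ * heightCoord X - (j + 1 - σ * heightCoord Y) =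
          -(σ * heightCoord (X - Y)) := by
        rw [heightCoord_sub]
        ring
      rw [e, abs_neg, abs_sign_mul_heightCoord hσ]
      exact abs_heightCoord_le _
    obtain ⟨t, ht, hle⟩ := hK.exists_level hlip (hSm j) one_pos
    rw [Real.one_rpow, ENNReal.ofReal_one, mul_one] at hle
    have h1 := htr (j + 1 - t) (by linarith [ht.2])
    have h2 : sKernel (n + 1) s (A (j + 1 - t) ×ˢ
        {X | X ∈ E ∧ baseCoord X ∈ Ω ∧ j + 1 - t ≤ σ * heightCoord X}) ≤
        K * volume (S j) + (c / 2 : ℝ≥0) * volume (A (j + 1 - t)) := by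
      refine le_trans (measure_mono (t := {X | t < j + 1 - σ * heightCoord X} ×ˢ
        (S j ∩ {Y | j + 1 - σ * heightCoord Y ≤ t}) ∪
        {z | z.1 ∈ A (j + 1 - t) ∧ H ≤ ‖z.1 - z.2‖}) ?_) ((measure_union_le _ _).trans
          (add_le_add (hle.trans ?_) ((hK.far hH (hAm _)).trans ?_)))
      · rintro ⟨X, Y⟩ ⟨hX, hYE, hYΩ, hYk⟩
        have hXk : σ * heightCoord X < j + 1 - t := hX.2.2.2
        have hYk' : j + 1 - t ≤ σ * heightCoord Y := hYk
        rcases le_or_gt (σ * heightCoord Y) (j + (1 + H)) with h | h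
        · refine Or.inl ⟨?_, ⟨hYE, hYΩ, by linarith [ht.2], h⟩, ?_⟩
          · change t < j + 1 - σ * heightCoord X
            linarith
          · change j + 1 - σ * heightCoord Y ≤ t
            linarith
        · refine Or.inr ⟨hX, ?_⟩
          have h3 := (abs_sign_mul_heightCoord hσ (Y - X)).trans_le (abs_heightCoord_le (Y - X))
          rw [heightCoord_sub, mul_sub] at h3
          change H ≤ ‖X - Y‖
          rw [norm_sub_rev]
          linarith [le_abs_self (σ * heightCoord Y - σ * heightCoord X), ht.1]
      · gcongr
        exact inter_subset_left
      · gcongr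
    have h4 := h1.trans h2
    have hcc : (c : ℝ≥0∞) = (c / 2 : ℝ≥0) + (c / 2 : ℝ≥0) := by
      exact_mod_cast (add_halves c).symm
    rw [hcc, add_mul] at h4
    have h5 := (ENNReal.add_le_add_iff_right
      (ENNReal.mul_lt_top ENNReal.coe_lt_top (hAfin (j + 1 - t))).ne).1 h4
    refine le_trans ?_ h5
    gcongr
    intro X hX
    exact ⟨hX.1, hX.2.1, hX.2.2.1, hX.2.2.2.trans (by linarith [ht.2])⟩
  have hlim : Filter.Tendsto (fun j : ℕ => ((c / 2 : ℝ≥0) : ℝ≥0∞) * volume (A ((j : ℝ) + 1)))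
      Filter.atTop (nhds ((c / 2 : ℝ≥0) * volume A')) := by
    refine ENNReal.Tendsto.const_mul ?_ (Or.inr ENNReal.coe_ne_top)
    have hun : A' = ⋃ j : ℕ, A ((j : ℝ) + 1) := by
      ext X
      simp only [mem_iUnion]
      constructor
      · rintro ⟨h1, h2, h3⟩
        obtain ⟨j, hj⟩ := exists_nat_gt (σ * heightCoord X)
        exact ⟨j, h1, h2, h3, by linarith⟩
      · rintro ⟨j, h1, h2, h3, -⟩
        exact ⟨h1, h2, h3⟩
    rw [hun]
    refine tendsto_measure_iUnion_atTop fun i j hij X hX => ?_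
    have : (i : ℝ) ≤ j := by exact_mod_cast hij
    exact ⟨hX.1, hX.2.1, hX.2.2.1, hX.2.2.2.trans_le (by linarith)⟩
  have hc2 : ((c / 2 : ℝ≥0) : ℝ≥0∞) ≠ 0 := by simpa using hc.ne'
  -- Uniformly bounded slabs make the volume above `M` finite. Then, for large `j`, the slabs lie in
  -- the tails of a set of finite volume, and the same inequality forces that volume to vanish.
  have hA'fin : volume A' ≠ ∞ := by
    have h1 : ((c / 2 : ℝ≥0) : ℝ≥0∞) * volume A' ≤
        K * volume (cyl Ω (Icc (-(1 + H)) (1 + H))) := by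
      refine le_of_tendsto' hlim fun j => (hstep _ (by positivity)).trans ?_
      refine mul_le_mul_right (le_trans (measure_mono fun X hX => ?_)
        (volume_slab_le hσ ((j : ℝ) + 1) (1 + H))) _
      exact hX.2
    have h2 : (K : ℝ≥0∞) * volume (cyl Ω (Icc (-(1 + H)) (1 + H))) < ∞ :=
      ENNReal.mul_lt_top (by simp) (isBounded_cyl hΩb (isBounded_Icc _ _)).measure_lt_top
    intro h
    rw [h, ENNReal.mul_top hc2] at h1
    exact absurd h2 (not_lt.2 h1)
  have hlim2 : Filter.Tendsto (fun j : ℕ => (K : ℝ≥0∞) * volume (A' ∩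
      {X | (j : ℝ) + 1 ≤ σ * heightCoord X})) Filter.atTop (nhds 0) := by
    have h1 : Filter.Tendsto (fun j : ℕ => volume (A' ∩ {X | (j : ℝ) + 1 ≤ σ * heightCoord X}))
        Filter.atTop (nhds (volume (⋂ j : ℕ, A' ∩ {X | (j : ℝ) + 1 ≤ σ * heightCoord X}))) := by
      refine tendsto_measure_iInter_atTop (fun j => (hA'm.inter
        (measurableSet_le measurable_const hhm)).nullMeasurableSet) (fun i j hij X hX => ?_)
        ⟨0, ((measure_mono inter_subset_left).trans_lt hA'fin.lt_top).ne⟩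
      have h2 : (i : ℝ) ≤ j := by exact_mod_cast hij
      have h3 : (j : ℝ) + 1 ≤ σ * heightCoord X := hX.2
      exact ⟨hX.1, show (i : ℝ) + 1 ≤ σ * heightCoord X by linarith⟩
    have h2 : ⋂ j : ℕ, A' ∩ {X | (j : ℝ) + 1 ≤ σ * heightCoord X} = ∅ := by
      refine eq_empty_of_forall_notMem fun X hX => ?_
      obtain ⟨j, hj⟩ := exists_nat_gt (σ * heightCoord X)
      have h3 : (j : ℝ) + 1 ≤ σ * heightCoord X := (mem_iInter.1 hX j).2
      linarith
    rw [h2, measure_empty] at h1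
    have h3 := ENNReal.Tendsto.const_mul (a := (K : ℝ≥0∞)) h1 (Or.inr (by simp))
    rwa [mul_zero] at h3
  have hle0 : ((c / 2 : ℝ≥0) : ℝ≥0∞) * volume A' ≤ 0 := by
    refine le_of_tendsto_of_tendsto hlim hlim2 ?_
    obtain ⟨N, hN⟩ := exists_nat_gt M
    filter_upwards [Filter.eventually_ge_atTop N] with j hj
    refine (hstep _ (by positivity)).trans ?_
    gcongr
    intro X hX
    have h2 : (N : ℝ) ≤ j := by exact_mod_cast hj
    exact ⟨⟨hX.1, hX.2.1, by linarith [hX.2.2.1]⟩, hX.2.2.1⟩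
  exact (mul_eq_zero.1 (le_antisymm hle0 zero_le)).resolve_left hc2

end Height

/-! ### Height bound, local minimizer and conclusion -/

section Main

variable {n : ℕ} {s : ℝ} {K : ℝ≥0} {Ω : Set (EuclideanSpace ℝ (Fin n))}
  {v : EuclideanSpace ℝ (Fin n) → ℝ}

/-- Over `Ω`, the set `E` lies below height `M` and contains everything below height `-M`. -/
def HeightTrapped (Ω : Set (EuclideanSpace ℝ (Fin n)))
    (E : Set (EuclideanSpace ℝ (Fin (n + 1)))) (M : ℝ) : Prop :=
  ∀ᵐ X : EuclideanSpace ℝ (Fin (n + 1)), baseCoord X ∈ Ω →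
    (M < heightCoord X → X ∉ E) ∧ (heightCoord X < -M → X ∈ E)

lemma heightTrapped_of_volume_eq_zero {E : Set (EuclideanSpace ℝ (Fin (n + 1)))} {M : ℝ}
    (h1 : volume {X | X ∈ E ∧ baseCoord X ∈ Ω ∧ M < 1 * heightCoord X} = 0)
    (h2 : volume {X | X ∈ Eᶜ ∧ baseCoord X ∈ Ω ∧ M < -1 * heightCoord X} = 0) :
    HeightTrapped Ω E M := by
  rw [measure_eq_zero_iff_ae_notMem] at h1 h2
  filter_upwards [h1, h2] with X h3 h4 hX
  refine ⟨fun h5 h6 => h3 ⟨h6, hX, by simpa using h5⟩, fun h5 => ?_⟩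
  by_contra h6
  exact h4 ⟨h6, hX, by linarith⟩

/-- Uniform height estimates for minimizers with exterior datum the subgraph of a locally bounded
function. -/
lemma exists_heightTrapped (hn : 1 ≤ n) (hs0 : 0 < s) (hK : SKernelBound (n + 1) s K)
    (hΩo : IsOpen Ω) (hΩb : Bornology.IsBounded Ω)
    (hv : ∀ r : ℝ, 0 < r → BddAbove ((fun x => |v x|) '' closedBall 0 r)) :
    ∃ M : ℝ, 0 < M ∧ (∀ x ∈ Ω, |v x| ≤ M) ∧
      (∀ E : Set (EuclideanSpace ℝ (Fin (n + 1))),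
        (E \ cyl Ω univ : Set _) =ᵐ[volume] (subgraph v \ cyl Ω univ : Set _) →
        (∀ k : ℝ, 0 < k → IsSMinimal s E (cyl Ω (Ioo (-k) k))) → HeightTrapped Ω E M) ∧
      ∀ k : ℝ, M < k → ∀ E : Set (EuclideanSpace ℝ (Fin (n + 1))),
        (E \ cyl Ω (Ioo (-k) k) : Set _) =ᵐ[volume] (subgraph v \ cyl Ω (Ioo (-k) k) : Set _) →
        IsSMinimal s E (cyl Ω (Ioo (-k) k)) → HeightTrapped Ω E M := by
  have hT : ∀ r : ℝ, ∃ T : ℝ, 0 < r → ∀ x, ‖x‖ ≤ r → |v x| ≤ T := by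
    intro r
    by_cases hr : 0 < r
    · obtain ⟨T, hT⟩ := hv r hr
      exact ⟨T, fun _ x hx => hT ⟨x, by simpa using hx, rfl⟩⟩
    · exact ⟨0, fun h => absurd h hr⟩
  choose T hT using hT
  obtain ⟨ρ, hρ⟩ := isBounded_iff_forall_norm_le.1 hΩb
  obtain ⟨c, hc, M₀, hM₀, htr⟩ := exists_truncation_constants hn hs0 hK hΩo hΩb T
  set M := max M₀ (T (max ρ 1)) with hM
  have hMpos : 0 < M := hM₀.trans_le (le_max_left _ _)
  have hvM : ∀ x ∈ Ω, |v x| ≤ M := fun x hx =>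
    (hT (max ρ 1) (by positivity) x ((hρ x hx).trans (le_max_left _ _))).trans (le_max_right _ _)
  have hext : ∀ E : Set (EuclideanSpace ℝ (Fin (n + 1))),
      (E \ cyl Ω univ : Set _) =ᵐ[volume] (subgraph v \ cyl Ω univ : Set _) →
      ∀ r : ℝ, 0 < r → ∀ᵐ X : EuclideanSpace ℝ (Fin (n + 1)), baseCoord X ∉ Ω →
        ‖baseCoord X‖ ≤ r → (T r < 1 * heightCoord X → X ∉ E) ∧
          (T r < -1 * heightCoord X → X ∉ Eᶜ) := by
    intro E hE r hr
    rw [diff_ae_eq_iff] at hE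
    filter_upwards [hE] with X hX hXΩ hXr
    have h1 := abs_le.1 (hT r hr _ hXr)
    have h2 : X ∈ E ↔ heightCoord X < v (baseCoord X) := hX fun h => hXΩ h.1
    rw [mem_compl_iff, h2]
    constructor <;> intro h <;> [skip; rw [not_not]] <;> linarith [h1.1, h1.2]
  refine ⟨M, hMpos, hvM, fun E hE hmin => ?_, fun k hk E hE hmin => ?_⟩
  · obtain ⟨E', -, hE'm, hEE'⟩ := (hmin 1 one_pos).1.exists_measurable_superset_ae_eq
    have hmin' : ∀ k : ℝ, 0 < k → IsSMinimal s E' (cyl Ω (Ioo (-k) k)) := fun k hk =>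
      (hmin k hk).congr
        (measurableSet_cyl hΩo.measurableSet measurableSet_Ioo).nullMeasurableSet hEE'.symm
    have hE' := hext E' ((hEE'.diff (ae_eq_refl _)).trans hE)
    have htrap : HeightTrapped Ω E' M := by
      refine heightTrapped_of_volume_eq_zero
        (volume_above_eq_zero hs0 hK hΩo hΩb (by norm_num) hE'm hc hMpos fun k hk => ?_)
        (volume_above_eq_zero hs0 hK hΩo hΩb (by norm_num) hE'm.compl hc hMpos fun k hk => ?_)
      · refine htr 1 (by norm_num) E' hE'm (fun r hr => ?_) M (le_max_left _ _) k (hmin' k hk)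
        filter_upwards [hE' r hr] with X hX h1 h2
        exact (hX h1 h2).1
      · refine htr (-1) (by norm_num) E'ᶜ hE'm.compl (fun r hr => ?_) M (le_max_left _ _) k
          ((hmin' k hk).compl
            (measurableSet_cyl hΩo.measurableSet measurableSet_Ioo).nullMeasurableSet)
        filter_upwards [hE' r hr] with X hX h1 h2
        exact (hX h1 h2).2
    filter_upwards [htrap, Filter.eventuallyEq_set.1 hEE'] with X h1 h2
    rwa [← h2]
  · have hUn : NullMeasurableSet (cyl Ω (Ioo (-k) k)) volume :=
      (measurableSet_cyl hΩo.measurableSet measurableSet_Ioo).nullMeasurableSet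
    obtain ⟨E', -, hE'm, hEE'⟩ := hmin.1.exists_measurable_superset_ae_eq
    have hmin' : IsSMinimal s E' (cyl Ω (Ioo (-k) k)) := hmin.congr hUn hEE'.symm
    have hE'k := diff_ae_eq_iff.1 ((hEE'.diff (ae_eq_refl _)).trans hE)
    have hE' := hext E' (diff_ae_eq_iff.2 (by
      filter_upwards [hE'k] with X hX hXΩ
      exact hX fun h => hXΩ ⟨h.1, mem_univ _⟩))
    -- Since `k > M` and `M` bounds `|v|` on `Ω`, the exterior datum is empty over `Ω` from height
    -- `k` on, so the right side of the truncation inequality vanishes for a single `k`.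
    have hup : ∀ᵐ X : EuclideanSpace ℝ (Fin (n + 1)),
        ¬(X ∈ E' ∧ baseCoord X ∈ Ω ∧ k ≤ 1 * heightCoord X) := by
      filter_upwards [hE'k] with X hX ⟨h1, h2, h3⟩
      have h4 : heightCoord X < v (baseCoord X) := (hX fun h => by
        have := h.2.2
        linarith).1 h1
      linarith [(abs_le.1 (hvM _ h2)).2]
    have hdn : ∀ᵐ X : EuclideanSpace ℝ (Fin (n + 1)),
        ¬(X ∈ E'ᶜ ∧ baseCoord X ∈ Ω ∧ k ≤ -1 * heightCoord X) := by
      filter_upwards [hE'k] with X hX ⟨h1, h2, h3⟩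
      refine h1 ((hX fun h => ?_).2 ?_)
      · have := h.2.1
        linarith
      · change heightCoord X < v (baseCoord X)
        linarith [(abs_le.1 (hvM _ h2)).1]
    have hzero : ∀ σ : ℝ, ∀ G : Set (EuclideanSpace ℝ (Fin (n + 1))),
        (∀ᵐ X : EuclideanSpace ℝ (Fin (n + 1)),
          ¬(X ∈ G ∧ baseCoord X ∈ Ω ∧ k ≤ σ * heightCoord X)) →
        c * volume {X | X ∈ G ∧ baseCoord X ∈ Ω ∧ M < σ * heightCoord X ∧ σ * heightCoord X < k} ≤
          sKernel (n + 1) s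
            ({X | X ∈ G ∧ baseCoord X ∈ Ω ∧ M < σ * heightCoord X ∧ σ * heightCoord X < k} ×ˢ
              {X | X ∈ G ∧ baseCoord X ∈ Ω ∧ k ≤ σ * heightCoord X}) →
        volume {X | X ∈ G ∧ baseCoord X ∈ Ω ∧ M < σ * heightCoord X} = 0 := by
      intro σ G hG hle
      have h1 : sKernel (n + 1) s
          ({X | X ∈ G ∧ baseCoord X ∈ Ω ∧ M < σ * heightCoord X ∧ σ * heightCoord X < k} ×ˢ
            {X | X ∈ G ∧ baseCoord X ∈ Ω ∧ k ≤ σ * heightCoord X}) = 0 := by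
        rw [measure_eq_zero_iff_ae_notMem]
        filter_upwards [ae_sKernel_snd hG] with z hz hz'
        exact hz hz'.2
      rw [h1] at hle
      have h2 := (mul_eq_zero.1 (le_antisymm hle zero_le)).resolve_left (by simpa using hc.ne')
      rw [measure_eq_zero_iff_ae_notMem] at h2 ⊢
      filter_upwards [h2, hG] with X h3 h4 ⟨h5, h6, h7⟩
      rcases lt_or_ge (σ * heightCoord X) k with h | h
      · exact h3 ⟨h5, h6, h7, h⟩
      · exact h4 ⟨h5, h6, h⟩
    have htrap : HeightTrapped Ω E' M := by
      refine heightTrapped_of_volume_eq_zero (hzero 1 E' hup ?_) (hzero (-1) E'ᶜ hdn ?_)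
      · refine htr 1 (by norm_num) E' hE'm (fun r hr => ?_) M (le_max_left _ _) k hmin'
        filter_upwards [hE' r hr] with X hX h1 h2
        exact (hX h1 h2).1
      · refine htr (-1) (by norm_num) E'ᶜ hE'm.compl (fun r hr => ?_) M (le_max_left _ _) k
          (hmin'.compl hUn)
        filter_upwards [hE' r hr] with X hX h1 h2
        exact (hX h1 h2).2
    filter_upwards [htrap, Filter.eventuallyEq_set.1 hEE'] with X h1 h2
    rwa [← h2]

lemma isLocallySMinimal_cyl_of_forall {E : Set (EuclideanSpace ℝ (Fin (n + 1)))}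
    (hΩo : IsOpen Ω) {k₀ : ℝ} (hE : ∀ k : ℝ, k₀ ≤ k → IsSMinimal s E (cyl Ω (Ioo (-k) k))) :
    IsLocallySMinimal s E (cyl Ω univ) := by
  refine IsSMinimal.isLocallySMinimal_of_exhaustion
    (W := fun j : ℕ => cyl Ω (Ioo (-(k₀ + j)) (k₀ + j)))
    (fun j => (measurableSet_cyl hΩo.measurableSet measurableSet_Ioo).nullMeasurableSet)
    (fun j => hE _ (by simp)) fun C hC hCU => ?_
  obtain ⟨R, hR⟩ := isBounded_iff_forall_norm_le.1 hC.isBounded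
  obtain ⟨j, hj⟩ := exists_nat_gt (R - k₀)
  refine ⟨j, fun X hX => ⟨(hCU hX).1, ?_⟩⟩
  have h1 := abs_le.1 ((abs_heightCoord_le X).trans (hR X hX))
  constructor <;> linarith [h1.1, h1.2]

lemma IsLocallySMinimal.isSMinimal_cyl (hn : 1 ≤ n) (hs1 : s < 1) (hK : SKernelBound (n + 1) s K)
    (hΩo : IsOpen Ω) (hΩb : Bornology.IsBounded Ω) (hΩ : HasC11Boundary Ω)
    {E : Set (EuclideanSpace ℝ (Fin (n + 1)))} (hE : NullMeasurableSet E volume)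
    (hloc : IsLocallySMinimal s E (cyl Ω univ)) (k : ℝ) : IsSMinimal s E (cyl Ω (Ioo (-k) k)) := by
  obtain ⟨C, hC⟩ := exists_boundaryLayerBound_cyl hn hΩo hΩb hΩ k
  have h1 : IsLocallySMinimal s E (cyl Ω (Ioo (-k) k)) := fun V hV hVc =>
    hloc V hV ⟨hVc.1, hVc.2.trans (cyl_mono Subset.rfl (subset_univ _))⟩
  exact h1.isSMinimal hK hs1 (isOpen_cyl hΩo isOpen_Ioo) (isBounded_cyl hΩb (isBounded_Ioo _ _))
    (cyl_compl_nonempty hn hΩb _) hC hE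

lemma exists_isSMinimal_cyl (hn : 1 ≤ n) (hs1 : s < 1) (hK : SKernelBound (n + 1) s K)
    (hΩo : IsOpen Ω) (hΩb : Bornology.IsBounded Ω) (hΩ : HasC11Boundary Ω)
    (hvm : AEMeasurable v volume) (k : ℝ) :
    ∃ E, IsSMinimal s E (cyl Ω (Ioo (-k) k)) ∧
      (E \ cyl Ω (Ioo (-k) k) : Set _) =ᵐ[volume] (subgraph v \ cyl Ω (Ioo (-k) k) : Set _) := by
  obtain ⟨C, hC⟩ := exists_boundaryLayerBound_cyl hn hΩo hΩb hΩ k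
  obtain ⟨G, -, hG, hGv⟩ := (nullMeasurableSet_subgraph hvm).exists_measurable_superset_ae_eq
  have hUo := isOpen_cyl hΩo (isOpen_Ioo (a := -k) (b := k))
  have hUfin := (isBounded_cyl hΩb (isBounded_Ioo (-k) k)).measure_lt_top (μ := volume)
  obtain ⟨E, hE, hEG⟩ := exists_isSMinimal hUo.measurableSet hUfin
    (sKernel_prod_compl_lt_top hK hs1 hUo (cyl_compl_nonempty hn hΩb _) hUfin hC) hG
  exact ⟨E, hE, hEG.trans (hGv.diff (ae_eq_refl _))⟩

/-- Existence of a locally `s`-minimal set in the infinite cylinder with subgraph exterior datum. -/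
lemma exists_isLocallySMinimal_cyl (hn : 1 ≤ n) (hs0 : 0 < s) (hs1 : s < 1)
    (hK : SKernelBound (n + 1) s K) (hΩo : IsOpen Ω) (hΩb : Bornology.IsBounded Ω)
    (hΩ : HasC11Boundary Ω) (hvm : AEMeasurable v volume)
    (hv : ∀ r : ℝ, 0 < r → BddAbove ((fun x => |v x|) '' closedBall 0 r)) :
    ∃ E, NullMeasurableSet E volume ∧ IsLocallySMinimal s E (cyl Ω univ) ∧
      (E \ cyl Ω univ : Set _) =ᵐ[volume] (subgraph v \ cyl Ω univ : Set _) := by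
  obtain ⟨M, hM, -, -, hheight⟩ := exists_heightTrapped hn hs0 hK hΩo hΩb hv
  obtain ⟨E, hE, hEv⟩ := exists_isSMinimal_cyl hn hs1 hK hΩo hΩb hΩ hvm (M + 1)
  have hEt := hheight (M + 1) (by linarith) E hEv hE
  have hUn : ∀ k : ℝ, NullMeasurableSet (cyl Ω (Ioo (-k) k)) volume := fun k =>
    (measurableSet_cyl hΩo.measurableSet measurableSet_Ioo).nullMeasurableSet
  refine ⟨E, hE.1, isLocallySMinimal_cyl_of_forall hΩo (k₀ := M + 1) fun k hk => ?_, ?_⟩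
  · obtain ⟨G, hG, hGv⟩ := exists_isSMinimal_cyl hn hs1 hK hΩo hΩb hΩ hvm k
    -- Both minimizers are trapped at the same height `M`, so they agree outside the cylinder of
    -- half-height `M + 1`, and minimality of `G` passes to `E`.
    have hGt := hheight k (by linarith) G hGv hG
    refine hG.extend hE (hUn _) (hUn _)
      (cyl_mono Subset.rfl (Ioo_subset_Ioo (by linarith) hk)) ?_
    rw [diff_ae_eq_iff] at hGv hEv ⊢
    filter_upwards [hGv, hEv, hEt, hGt] with X h1 h2 h3 h4 h5
    rw [h2 h5]
    by_cases hXΩ : baseCoord X ∈ Ω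
    · have h6 : ¬(-(M + 1) < heightCoord X ∧ heightCoord X < M + 1) := fun h => h5 ⟨hXΩ, h⟩
      rw [← h2 h5]
      rcases not_and_or.1 h6 with h7 | h7
      · exact iff_of_true ((h4 hXΩ).2 (by linarith)) ((h3 hXΩ).2 (by linarith))
      · exact iff_of_false ((h4 hXΩ).1 (by linarith)) ((h3 hXΩ).1 (by linarith))
    · exact h1 fun h => hXΩ h.1
  · rw [diff_ae_eq_iff] at hEv ⊢
    filter_upwards [hEv] with X hX hXΩ
    exact hX fun h => hXΩ ⟨h.1, mem_univ _⟩

/-- The unit of slack turns the strict inequalities of `HeightTrapped` into closed ones, with no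
need to discuss the slices at height `±M`. -/
lemma HeightTrapped.isHeightBound_conclusion {E : Set (EuclideanSpace ℝ (Fin (n + 1)))} {M : ℝ}
    (hE : HeightTrapped Ω E M) (hvM : ∀ x ∈ Ω, |v x| ≤ M)
    (hEv : (E \ cyl Ω univ : Set _) =ᵐ[volume] (subgraph v \ cyl Ω univ : Set _)) :
    cyl Ω (Iic (-(M + 1))) ≤ᵐ[volume]
        (E ∩ cyl Ω univ : Set (EuclideanSpace ℝ (Fin (n + 1)))) ∧
      (E ∩ cyl Ω univ : Set (EuclideanSpace ℝ (Fin (n + 1)))) ≤ᵐ[volume]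
        cyl Ω (Iic (M + 1)) ∧
      (E \ cyl Ω (Icc (-(M + 1)) (M + 1)) : Set (EuclideanSpace ℝ (Fin (n + 1)))) =ᵐ[volume]
        (subgraph v \ cyl Ω (Icc (-(M + 1)) (M + 1)) :
          Set (EuclideanSpace ℝ (Fin (n + 1)))) := by
  refine ⟨?_, ?_, ?_⟩
  · filter_upwards [hE] with X hX hXM
    obtain ⟨h1, h2⟩ : baseCoord X ∈ Ω ∧ heightCoord X ≤ -(M + 1) := hXM
    exact ⟨(hX h1).2 (by linarith), h1, mem_univ _⟩
  · filter_upwards [hE] with X hX hXM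
    obtain ⟨h1, h2, -⟩ : X ∈ E ∧ baseCoord X ∈ Ω ∧ heightCoord X ∈ univ := hXM
    exact ⟨h2, not_lt.1 fun (h3 : M + 1 < heightCoord X) => (hX h2).1 (by linarith) h1⟩
  · rw [diff_ae_eq_iff] at hEv ⊢
    filter_upwards [hE, hEv] with X hX hXv hXM
    by_cases hXΩ : baseCoord X ∈ Ω
    · have h1 : ¬(-(M + 1) ≤ heightCoord X ∧ heightCoord X ≤ M + 1) := fun h => hXM ⟨hXΩ, h⟩
      have h2 := abs_le.1 (hvM _ hXΩ)
      have h3 : X ∈ subgraph v ↔ heightCoord X < v (baseCoord X) := Iff.rfl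
      rw [h3]
      rcases not_and_or.1 h1 with h4 | h4
      · exact iff_of_true ((hX hXΩ).2 (by linarith)) (by linarith [h2.1])
      · exact iff_of_false ((hX hXΩ).1 (by linarith)) (by linarith [h2.2])
    · exact hXv fun h => hXΩ h.1

end Main

theorem mainTheorem12 (n : ℕ) (hn : 1 ≤ n) (s : ℝ) (hs0 : 0 < s) (hs1 : s < 1)
    (Ω : Set (EuclideanSpace ℝ (Fin n))) (hΩo : IsOpen Ω) (hΩb : Bornology.IsBounded Ω)
    (hΩ : HasC11Boundary Ω)
    (v : EuclideanSpace ℝ (Fin n) → ℝ) (hvm : AEMeasurable v volume)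
    (hv : ∀ r : ℝ, 0 < r → BddAbove ((fun x => |v x|) '' closedBall 0 r)) :
    (∃ M : ℝ, 0 < M ∧ IsHeightBound s Ω v M) ∧
    ∀ M : ℝ, 0 < M → IsHeightBound s Ω v M →
      ∀ k₀ : ℤ, IsLeast {k : ℤ | M < (k : ℝ)} k₀ →
      ∀ F : Set (EuclideanSpace ℝ (Fin (n + 1))),
        IsSMinimal s F (cyl Ω (Ioo (-(k₀ : ℝ)) k₀)) →
        (F \ cyl Ω (Ioo (-(k₀ : ℝ)) k₀) : Set (EuclideanSpace ℝ (Fin (n + 1)))) =ᵐ[volume]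
          (subgraph v \ cyl Ω (Ioo (-(k₀ : ℝ)) k₀) :
            Set (EuclideanSpace ℝ (Fin (n + 1)))) →
        (∀ k : ℝ, (k₀ : ℝ) ≤ k → IsSMinimal s F (cyl Ω (Ioo (-k) k))) ∧
          IsLocallySMinimal s F (cyl Ω univ) := by
  obtain ⟨K, hK⟩ := exists_sKernelBound n.succ_pos hs0 hs1
  refine ⟨?_, ?_⟩
  · obtain ⟨M, hM, hvM, hheight, -⟩ := exists_heightTrapped hn hs0 hK hΩo hΩb hv
    refine ⟨M + 1, by linarith, fun E hE hloc hEv => ?_⟩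
    exact (hheight E hEv fun k _ =>
      hloc.isSMinimal_cyl hn hs1 hK hΩo hΩb hΩ hE k).isHeightBound_conclusion hvM hEv
  · intro M hM hbound k₀ hk₀ F hF hFv
    have hMk : M < k₀ := hk₀.1
    -- An a priori bound says nothing about `F` directly, as `F` is not yet known to be locally
    -- minimal. It is applied to a locally minimal `E`, whose minimality in each larger cylinder is
    -- then handed to `F`.
    obtain ⟨E, hE, hloc, hEv⟩ := exists_isLocallySMinimal_cyl hn hs0 hs1 hK hΩo hΩb hΩ hvm hv
    have hEM := (hbound E hE hloc hEv).2.2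
    have hUn : ∀ k : ℝ, NullMeasurableSet (cyl Ω (Ioo (-k) k)) volume := fun k =>
      (measurableSet_cyl hΩo.measurableSet measurableSet_Ioo).nullMeasurableSet
    have hFk : ∀ k : ℝ, (k₀ : ℝ) ≤ k → IsSMinimal s F (cyl Ω (Ioo (-k) k)) := by
      intro k hk
      refine (hloc.isSMinimal_cyl hn hs1 hK hΩo hΩb hΩ hE k).extend hF (hUn _) (hUn _)
        (cyl_mono Subset.rfl (Ioo_subset_Ioo (by linarith) hk)) ?_
      rw [diff_ae_eq_iff] at hEM hFv ⊢
      filter_upwards [hEM, hFv] with X h1 h2 h3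
      rw [h2 h3]
      exact h1 fun h => h3 ⟨h.1, by linarith [h.2.1], by linarith [h.2.2]⟩
    exact ⟨hFk, isLocallySMinimal_cyl_of_forall hΩo hFk⟩
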